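/- **Conventions.** Graphs are finite, undirected, without loops or multiple edges; $\otimes$ is the minimal tensor product of C*-algebras. A *compact matrix quantum group* $\mathbb G$ is a unital C*-algebra $C(\mathbb G)$ generated by the entries of a matrix $u=(u_{ij})$ such that $u$ and $u^T$ are invertible and there is a $*$-homomorphism $\Delta_{\mathbb G}: C(\mathbb G)\to C(\mathbb G)\otimes C(\mathbb G)$ with $\Delta_{\mathbb G}(u_{ij})=\sum_k u_{ik}\otimes u_{kj}$. We write $\mathbb G\cong\mathbb H$ if there is a $*$-isomorphism $\varphi:C(\mathbb G)\to C(\mathbb H)$ with $\Delta_{\mathbb H}\circ\varphi=(\varphi\otimes\varphi)\circ\Delta_{\mathbb G}$. A matrix $u$ over a unital C*-algebra is a *magic unitary* if $u_{ij}=u_{ij}^*=u_{ij}^2$ and $\sum_l u_{il}=1=\sum_l u_{li}$ for all $i,j$. **Quantum automorphism groups.** Let $H$ be a graph whose vertices and edges are colored by a function $c$, and let $A_{H_t}$ be the adjacency matrix of the set of edges of color $t$. Then $\mathrm{Qut}(H)$ is the compact matrix quantum group whose C*-algebra is the universal C*-algebra generated by the entries of a magic unitary $u=(u_{ij})_{i,j\in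 V(H)}$ with $u_{ij}=0$ whenever $c(i)\ne c(j)$, and $uA_{H_t}=A_{H_t}u$ for every edge color $t$. If only the edges of $H$ are colored, or nothing is, all vertices, respectively all vertices and all edges, are regarded as having one and the same color. For an edge-colored graph $H$ and an edge color $c_0$, $\mathrm{Qut}^*_{c_0}(H)$ is the compact matrix quantum group whose C*-algebra is the universal C*-algebra generated by the entries of a magic unitary $x=(x_{ij})_{i,j\in V(H)}$ with $xA_{H_t}=A_{H_t}x$ for every edge color $t$, and $x_{ik}x_{jl}=x_{jl}x_{ik}$ for all $i,j,k,l\in V(H)$ such that $(i,j)$ and $(k,l)$ are edges of $H$ with $c((i,j))=c((k,l))\neq c_0$. **Decolored graphs.** Let $G$ be a vertex- and edge-colored graph with coloring $c$. Choose an edge color $c_0$; lengths $n_s\in\mathbb N_0$ for the vertex colors $s$, with $n_s\ne n_{s'}$ for distinct $s,s'$; and lengths $m_t\in\mathbb N_0$ for the edge colors $t\neq c_0$, with $m_t\neq m_{t'}$ for distinct $t,t'$. The edge-colored graph $G'$ is obtained from $G$ by attaching to every vertex $v$ a path of length $n_{c(v)}$, coloring all edges of these paths with $c_0$, keeping the colors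 of the edges of $G$, and forgetting the colors of the vertices. The uncolored graph $G''$ is obtained from $G'$ by subdividing every edge $e$ of color $c(e)\neq c_0$ by a new vertex, attaching to this new vertex a path of length $m_{c(e)}$, and forgetting the colors of the edges. **Statement.** Let $G$ be a vertex- and edge-colored graph such that $\deg(v)\ge 3$ for all $v\in V(G)$, and let $G'$ and $G''$ be constructed from $G$ as above, for any choice of $c_0$, $(n_s)$ and $(m_t)$. If $\mathrm{Qut}^*_{c_0}(G')\cong \mathrm{Qut}(G')$, then $\mathrm{Qut}(G'')\cong \mathrm{Qut}(G)$. -/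

import Mathlib

open scoped TensorProduct
universe u v w w'

/-- A C*-seminorm on a unital complex `*`-algebra: a submultiplicative seminorm with
`p (star a * a) = p a ^ 2`. -/
structure CStarSeminorm (A : Type u) [Ring A] [StarRing A] [Algebra ℂ A] extends Seminorm ℂ A where
  mul_le' : ∀ a b, toFun (a * b) ≤ toFun a * toFun b
  star_mul_self' : ∀ a, toFun (star a * a) = toFun a * toFun a

namespace CStarSeminorm
section basic
variable {A : Type u} [Ring A] [StarRing A] [Algebra ℂ A]

instance : FunLike (CStarSeminorm A) A ℝ where
  coe p := p.toFun
  coe_injective := by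
    rintro ⟨p, _, _⟩ ⟨q, _, _⟩ h
    congr
    exact DFunLike.coe_injective h

instance : SeminormClass (CStarSeminorm A) ℂ A where
  map_zero p := p.map_zero'
  map_add_le_add p := p.add_le'
  map_neg_eq_map p := p.neg'
  map_smul_eq_mul p := p.smul'

variable (p : CStarSeminorm A)
theorem mul_le (a b : A) : p (a * b) ≤ p a * p b := p.mul_le' a b
theorem star_mul_self (a : A) : p (star a * a) = p a * p a := p.star_mul_self' a

theorem le_star (a : A) : p a ≤ p (star a) := by
  by_contra! h
  have h1 := p.mul_le (star a) a
  rw [star_mul_self] at h1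
  have h2 : 0 ≤ p (star a) := apply_nonneg p _
  nlinarith

theorem map_star (a : A) : p (star a) = p a :=
  le_antisymm (by simpa using p.le_star (star a)) (p.le_star a)

/-- The C*-seminorm `a ↦ ‖f a‖` of a `*`-homomorphism `f` into a C*-algebra. -/
def ofHom {B : Type v} [CStarAlgebra B] (f : A →⋆ₐ[ℂ] B) : CStarSeminorm A where
  toFun a := ‖f a‖
  map_zero' := by simp
  add_le' a b := by rw [map_add]; exact norm_add_le _ _
  neg' a := by simp
  smul' c a := by rw [map_smul, norm_smul]
  mul_le' a b := by rw [map_mul]; exact norm_mul_le _ _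
  star_mul_self' a := by rw [map_mul, StarHomClass.map_star, CStarRing.norm_star_mul_self]

@[simp] theorem ofHom_apply {B : Type v} [CStarAlgebra B] (f : A →⋆ₐ[ℂ] B) (a : A) :
    ofHom f a = ‖f a‖ := rfl

/-- The pointwise supremum of a pointwise bounded set of C*-seminorms (`0` for the empty set). -/
noncomputable def sup (S : Set (CStarSeminorm A))
    (hS : ∀ a, BddAbove (Set.range fun p : S => p.1 a)) :
    CStarSeminorm A where
  toFun a := ⨆ p : S, p.1 a
  map_zero' := by simp
  add_le' a b := by
    refine Real.iSup_le (fun p => (map_add_le_add p.1 a b).trans ?_) ?_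
    · exact add_le_add (le_ciSup (hS a) p) (le_ciSup (hS b) p)
    · exact add_nonneg (Real.iSup_nonneg fun p => apply_nonneg _ _)
        (Real.iSup_nonneg fun p => apply_nonneg _ _)
  neg' a := by simp
  smul' c a := by
    rw [Real.mul_iSup_of_nonneg (norm_nonneg c)]
    exact iSup_congr fun p => map_smul_eq_mul p.1 c a
  mul_le' a b := by
    refine Real.iSup_le (fun p => (p.1.mul_le a b).trans ?_) ?_
    · exact mul_le_mul (le_ciSup (hS a) p) (le_ciSup (hS b) p) (apply_nonneg _ _)
        (Real.iSup_nonneg fun p => apply_nonneg _ _)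
    · exact mul_nonneg (Real.iSup_nonneg fun p => apply_nonneg _ _)
        (Real.iSup_nonneg fun p => apply_nonneg _ _)
  star_mul_self' a := by
    have h0 : 0 ≤ ⨆ p : S, p.1 a := Real.iSup_nonneg fun p => apply_nonneg _ _
    apply le_antisymm
    · refine Real.iSup_le (fun p => ?_) (mul_nonneg h0 h0)
      rw [star_mul_self]
      exact mul_self_le_mul_self (apply_nonneg _ _) (le_ciSup (hS a) p)
    · have h1 : 0 ≤ ⨆ p : S, p.1 (star a * a) := Real.iSup_nonneg fun p => apply_nonneg _ _
      have h2 : (⨆ p : S, p.1 a) ≤ √(⨆ p : S, p.1 (star a * a)) := by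
        refine Real.iSup_le (fun p => Real.le_sqrt_of_sq_le ?_) (Real.sqrt_nonneg _)
        rw [pow_two, ← star_mul_self]
        exact le_ciSup (hS (star a * a)) p
      exact (mul_self_le_mul_self h0 h2).trans (Real.mul_self_sqrt h1).le

theorem le_sup {S : Set (CStarSeminorm A)} {hS : ∀ a, BddAbove (Set.range fun p : S => p.1 a)}
    {p : CStarSeminorm A} (hp : p ∈ S) (a : A) : p a ≤ sup S hS a :=
  le_ciSup (hS a) ⟨p, hp⟩

theorem sup_le {S : Set (CStarSeminorm A)} {hS : ∀ a, BddAbove (Set.range fun p : S => p.1 a)}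
    {a : A} {r : ℝ} (hr : 0 ≤ r) (h : ∀ p ∈ S, p a ≤ r) : sup S hS a ≤ r :=
  Real.iSup_le (fun p => h p.1 p.2) hr

/-- The algebra `A`, seminormed by `p`. -/
def Carrier (_ : CStarSeminorm A) : Type u := A

instance : Ring p.Carrier := inferInstanceAs (Ring A)
instance : StarRing p.Carrier := inferInstanceAs (StarRing A)
instance : Algebra ℂ p.Carrier := inferInstanceAs (Algebra ℂ A)
instance [StarModule ℂ A] : StarModule ℂ p.Carrier := inferInstanceAs (StarModule ℂ A)

/-- The identity map. -/
def toCarrier : A ≃ₐ[ℂ] p.Carrier := AlgEquiv.refl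

noncomputable instance : SeminormedRing p.Carrier where
  __ := (inferInstance : Ring p.Carrier)
  __ := AddGroupSeminorm.toSeminormedAddCommGroup (E := p.Carrier)
    p.toSeminorm.toAddGroupSeminorm
  norm_mul_le a b := p.mul_le a b

theorem norm_toCarrier (a : A) : ‖p.toCarrier a‖ = p a := rfl

noncomputable instance : NormedAlgebra ℂ p.Carrier where
  norm_smul_le c a := (map_smul_eq_mul p c a).le

/-- The Hausdorff completion of `A` with respect to the C*-seminorm `p`, a C*-algebra. -/
def Completion : Type u := UniformSpace.Completion p.Carrier

section instances

noncomputable abbrev normedRing : NormedRing p.Completion :=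
  inferInstanceAs (NormedRing (UniformSpace.Completion p.Carrier))
attribute [local instance] normedRing

theorem completeSpace : CompleteSpace p.Completion :=
  inferInstanceAs (CompleteSpace (UniformSpace.Completion p.Carrier))
attribute [local instance] completeSpace

noncomputable abbrev normedAlgebra : NormedAlgebra ℂ p.Completion where
  __ := (inferInstance : Algebra ℂ (UniformSpace.Completion p.Carrier))
  norm_smul_le := norm_smul_le (α := ℂ) (β := UniformSpace.Completion p.Carrier)
attribute [local instance] normedAlgebra

theorem isometry_star : Isometry (star : p.Carrier → p.Carrier) :=
  AddMonoidHomClass.isometry_of_norm (starAddEquiv (R := p.Carrier)).toAddMonoidHom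
    fun a => p.map_star a

/-- The canonical map from `A` to the completion. -/
noncomputable def of (a : A) : p.Completion :=
  ((p.toCarrier a : p.Carrier) : UniformSpace.Completion p.Carrier)

theorem induction_on {P : p.Completion → Prop} (x : p.Completion) (hc : IsClosed {x | P x})
    (h : ∀ a, P (p.of a)) : P x :=
  UniformSpace.Completion.induction_on x hc h

theorem induction_on₂ {P : p.Completion → p.Completion → Prop} (x y : p.Completion)
    (hc : IsClosed {x : p.Completion × p.Completion | P x.1 x.2})
    (h : ∀ a b, P (p.of a) (p.of b)) : P x y :=
  UniformSpace.Completion.induction_on₂ x y hc h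

theorem of_add (a b : A) : p.of (a + b) = p.of a + p.of b := UniformSpace.Completion.coe_add _ _
theorem of_mul (a b : A) : p.of (a * b) = p.of a * p.of b := UniformSpace.Completion.coe_mul _ _
theorem of_one : p.of 1 = 1 := UniformSpace.Completion.coe_one _
theorem of_algebraMap (c : ℂ) : p.of (algebraMap ℂ A c) = algebraMap ℂ p.Completion c := rfl
theorem of_smul (c : ℂ) (a : A) : p.of (c • a) = c • p.of a := by
  rw [Algebra.smul_def, of_mul, of_algebraMap, ← Algebra.smul_def]
theorem norm_of (a : A) : ‖p.of a‖ = p a := UniformSpace.Completion.norm_coe _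

noncomputable abbrev hasStar : Star p.Completion where
  star := UniformSpace.Completion.map (star : p.Carrier → p.Carrier)
attribute [local instance] hasStar

theorem of_star (a : A) : p.of (star a) = star (p.of a) :=
  (UniformSpace.Completion.map_coe p.isometry_star.uniformContinuous _).symm

theorem continuous_star : Continuous (star : p.Completion → p.Completion) :=
  UniformSpace.Completion.continuous_map

theorem hasContinuousStar : ContinuousStar p.Completion where
  continuous_star := UniformSpace.Completion.continuous_map
attribute [local instance] hasContinuousStar

noncomputable abbrev starRing : StarRing p.Completion where
  star_involutive x := by
    refine p.induction_on (P := fun x => star (star x) = x) x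
      (isClosed_eq (by fun_prop) (by fun_prop)) fun a => ?_
    rw [← of_star, ← of_star, star_star]
  star_mul x y := by
    refine p.induction_on₂ (P := fun x y => star (x * y) = star y * star x) x y
      (isClosed_eq (by fun_prop) (by fun_prop)) fun a b => ?_
    rw [← of_mul, ← of_star, ← of_star, ← of_star, ← of_mul, star_mul]
  star_add x y := by
    refine p.induction_on₂ (P := fun x y => star (x + y) = star x + star y) x y
      (isClosed_eq (by fun_prop) (by fun_prop)) fun a b => ?_
    rw [← of_add, ← of_star, ← of_star, ← of_star, ← of_add, star_add]
attribute [local instance] starRing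

theorem cstarRing : CStarRing p.Completion where
  norm_mul_self_le x := by
    refine p.induction_on (P := fun x => ‖x‖ * ‖x‖ ≤ ‖star x * x‖) x
      (isClosed_le (by fun_prop) (by fun_prop)) fun a => ?_
    rw [← of_star, ← of_mul, norm_of, norm_of, star_mul_self]
attribute [local instance] cstarRing

theorem starModule [StarModule ℂ A] : StarModule ℂ p.Completion where
  star_smul c x := by
    rw [Algebra.smul_def, star_mul, ← of_algebraMap, ← of_star, Algebra.smul_def, ← of_algebraMap,
      ← algebraMap_star_comm, of_algebraMap, Algebra.commutes]
attribute [local instance] starModule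

noncomputable instance [StarModule ℂ A] : CStarAlgebra p.Completion where

end instances

variable [StarModule ℂ A]

/-- The canonical `*`-homomorphism from `A` to the completion. -/
noncomputable def toCompletion : A →⋆ₐ[ℂ] p.Completion where
  toFun := p.of
  map_one' := p.of_one
  map_mul' := p.of_mul
  map_zero' := UniformSpace.Completion.coe_zero
  map_add' := p.of_add
  commutes' := p.of_algebraMap
  map_star' := p.of_star

theorem norm_toCompletion (a : A) : ‖p.toCompletion a‖ = p a := p.norm_of a

theorem denseRange_toCompletion : DenseRange p.toCompletion :=
  UniformSpace.Completion.denseRange_coe (α := p.Carrier)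

section lift
variable {p} {B : Type v} [CStarAlgebra B]

/-- `f`, as a ring homomorphism on the seminormed ring. -/
def carrierHom (p : CStarSeminorm A) (f : A →⋆ₐ[ℂ] B) : p.Carrier →+* B := (f : A →+* B)

theorem continuous_carrier (f : A →⋆ₐ[ℂ] B) (hf : ∀ a, ‖f a‖ ≤ p a) :
    Continuous (carrierHom p f) :=
  AddMonoidHomClass.continuous_of_bound (carrierHom p f) 1
    fun a => by rw [one_mul]; exact hf a

/-- The extension by continuity of a `*`-homomorphism, as a ring homomorphism. -/
noncomputable def extend (f : A →⋆ₐ[ℂ] B) (hf : ∀ a, ‖f a‖ ≤ p a) : p.Completion →+* B :=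
  UniformSpace.Completion.extensionHom (carrierHom p f) (continuous_carrier f hf)

theorem extend_of (f : A →⋆ₐ[ℂ] B) (hf : ∀ a, ‖f a‖ ≤ p a) (a : A) :
    extend f hf (p.of a) = f a :=
  UniformSpace.Completion.extensionHom_coe _ (continuous_carrier f hf) _

theorem continuous_extend (f : A →⋆ₐ[ℂ] B) (hf : ∀ a, ‖f a‖ ≤ p a) : Continuous (extend f hf) :=
  UniformSpace.Completion.continuous_extension

/-- The extension by continuity of a `*`-homomorphism dominated by the seminorm. -/
noncomputable def lift (f : A →⋆ₐ[ℂ] B) (hf : ∀ a, ‖f a‖ ≤ p a) : p.Completion →⋆ₐ[ℂ] B where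
  __ := extend f hf
  commutes' c := (extend_of f hf (algebraMap ℂ A c)).trans (AlgHomClass.commutes f c)
  map_star' x := by
    have hc := continuous_extend f hf
    refine p.induction_on (P := fun x => extend f hf (star x) = star (extend f hf x)) x
      (isClosed_eq (by fun_prop) (by fun_prop)) fun a => ?_
    rw [← of_star, extend_of, extend_of, StarHomClass.map_star]

theorem lift_toCompletion (f : A →⋆ₐ[ℂ] B) (hf : ∀ a, ‖f a‖ ≤ p a) (a : A) :
    lift f hf (p.toCompletion a) = f a :=
  extend_of f hf a

end lift
end basic
end CStarSeminorm

/-! ### The minimal tensor product of C*-algebras -/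
section tensor
open UniformSpace

variable {A : Type u} {B : Type v} [CStarAlgebra A] [CStarAlgebra B]

section reps
variable {H : Type u} [NormedAddCommGroup H] [InnerProductSpace ℂ H]
  {K : Type v} [NormedAddCommGroup K] [InnerProductSpace ℂ K]

variable (H K) in
/-- The Hilbert space tensor product: the completion of the algebraic tensor product. -/
def HilbertTensor : Type (max u v) := Completion (H ⊗[ℂ] K)

noncomputable instance : NormedAddCommGroup (HilbertTensor H K) :=
  inferInstanceAs (NormedAddCommGroup (Completion (H ⊗[ℂ] K)))
noncomputable instance : InnerProductSpace ℂ (HilbertTensor H K) :=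
  inferInstanceAs (InnerProductSpace ℂ (Completion (H ⊗[ℂ] K)))
instance : CompleteSpace (HilbertTensor H K) :=
  inferInstanceAs (CompleteSpace (Completion (H ⊗[ℂ] K)))

/-- The canonical map from the algebraic to the Hilbert space tensor product. -/
noncomputable def HilbertTensor.of (x : H ⊗[ℂ] K) : HilbertTensor H K :=
  (x : Completion (H ⊗[ℂ] K))

/-- The bounded operator `S ⊗ T` on the Hilbert space tensor product. -/
noncomputable def opTensor (S : H →L[ℂ] H) (T : K →L[ℂ] K) :
    HilbertTensor H K →L[ℂ] HilbertTensor H K :=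
  ((TensorProduct.mapL S T).completion : Completion (H ⊗[ℂ] K) →L[ℂ] Completion (H ⊗[ℂ] K))

theorem opTensor_ext {P Q : HilbertTensor H K →L[ℂ] HilbertTensor H K}
    (h : ∀ x, P (.of x) = Q (.of x)) : P = Q := by
  ext x
  exact Completion.induction_on (p := fun x => P x = Q x) x
    (isClosed_eq P.continuous Q.continuous) h

theorem opTensor_of (S : H →L[ℂ] H) (T : K →L[ℂ] K) (x : H ⊗[ℂ] K) :
    opTensor S T (.of x) = .of (TensorProduct.mapL S T x) :=
  ContinuousLinearMap.completion_apply_coe _ _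

theorem HilbertTensor.of_add (x y : H ⊗[ℂ] K) : of (x + y) = of x + of y := Completion.coe_add _ _
theorem HilbertTensor.of_smul (c : ℂ) (x : H ⊗[ℂ] K) : of (c • x) = c • of x :=
  Completion.coe_smul _ _

theorem opTensor_mul (S S' : H →L[ℂ] H) (T T' : K →L[ℂ] K) :
    opTensor (S * S') (T * T') = opTensor S T * opTensor S' T' :=
  opTensor_ext fun x => by
    rw [mul_apply_eq_comp, opTensor_of, opTensor_of, opTensor_of,
      TensorProduct.mapL_mul, mul_apply_eq_comp]

theorem opTensor_one : opTensor (1 : H →L[ℂ] H) (1 : K →L[ℂ] K) = 1 :=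
  opTensor_ext fun x => by
    rw [opTensor_of]
    exact congrArg _ (DFunLike.congr_fun TensorProduct.mapL_id_id x)

theorem norm_opTensor_le (S : H →L[ℂ] H) (T : K →L[ℂ] K) : ‖opTensor S T‖ ≤ ‖S‖ * ‖T‖ := by
  refine ContinuousLinearMap.opNorm_le_bound _ (by positivity) fun x => ?_
  refine Completion.induction_on (p := fun x => ‖opTensor S T x‖ ≤ ‖S‖ * ‖T‖ * ‖x‖) x
    (isClosed_le (by fun_prop) (by fun_prop)) fun a => ?_
  refine (congrArg norm (opTensor_of S T a)).le.trans ?_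
  refine (Completion.norm_coe (TensorProduct.mapL S T a)).le.trans ?_
  refine (ContinuousLinearMap.le_of_opNorm_le _ (TensorProduct.norm_mapL_le S T) a).trans ?_
  exact (congrArg (‖S‖ * ‖T‖ * ·) (Completion.norm_coe a).symm).le

/-- The bilinear map `(S, T) ↦ S ⊗ T` on bounded operators. -/
noncomputable def opTensorBilin :
    (H →L[ℂ] H) →ₗ[ℂ] (K →L[ℂ] K) →ₗ[ℂ] (HilbertTensor H K →L[ℂ] HilbertTensor H K) :=
  LinearMap.mk₂ ℂ opTensor
    (fun S S' T => opTensor_ext fun x => by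
      change _ = opTensor S T (.of x) + opTensor S' T (.of x)
      simp only [opTensor_of, TensorProduct.mapL_add_left, ← HilbertTensor.of_add]
      rfl)
    (fun c S T => opTensor_ext fun x => by
      change _ = c • opTensor S T (.of x)
      simp only [opTensor_of, TensorProduct.mapL_smul_left, ← HilbertTensor.of_smul]
      rfl)
    (fun S T T' => opTensor_ext fun x => by
      change _ = opTensor S T (.of x) + opTensor S T' (.of x)
      simp only [opTensor_of, TensorProduct.mapL_add_right, ← HilbertTensor.of_add]
      rfl)
    (fun c S T => opTensor_ext fun x => by
      change _ = c • opTensor S T (.of x)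
      simp only [opTensor_of, TensorProduct.mapL_smul_right, ← HilbertTensor.of_smul]
      rfl)

variable [CompleteSpace H] [CompleteSpace K]

theorem inner_mapL (S : H →L[ℂ] H) (T : K →L[ℂ] K) (x y : H ⊗[ℂ] K) :
    inner ℂ (TensorProduct.mapL (star S) (star T) x) y = inner ℂ x (TensorProduct.mapL S T y) := by
  induction x using TensorProduct.induction_on with
  | zero => simp
  | add a b ha hb => rw [map_add, inner_add_left, inner_add_left, ha, hb]
  | tmul h k =>
    induction y using TensorProduct.induction_on with
    | zero => simp
    | add a b ha hb => rw [map_add, inner_add_right, inner_add_right, ha, hb]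
    | tmul h' k' =>
      simp [ContinuousLinearMap.star_eq_adjoint, ContinuousLinearMap.adjoint_inner_left]

theorem opTensor_star (S : H →L[ℂ] H) (T : K →L[ℂ] K) :
    opTensor (star S) (star T) = star (opTensor S T) := by
  rw [ContinuousLinearMap.star_eq_adjoint (opTensor S T), ContinuousLinearMap.eq_adjoint_iff]
  intro x y
  refine Completion.induction_on₂
    (p := fun x y => inner ℂ (opTensor (star S) (star T) x) y = inner ℂ x (opTensor S T y)) x y
    (isClosed_eq (by fun_prop) (by fun_prop)) fun a b => ?_
  refine (congrArg (inner ℂ · (HilbertTensor.of b)) (opTensor_of _ _ a)).trans ?_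
  refine Eq.trans ?_ (congrArg (inner ℂ (HilbertTensor.of a)) (opTensor_of S T b)).symm
  refine (Completion.inner_coe (𝕜 := ℂ) _ b).trans ?_
  exact (inner_mapL S T a b).trans (Completion.inner_coe (𝕜 := ℂ) a _).symm

/-- The linear map `a ⊗ b ↦ π a ⊗ ρ b`. -/
noncomputable def repTensorLinear (π : A →⋆ₐ[ℂ] (H →L[ℂ] H)) (ρ : B →⋆ₐ[ℂ] (K →L[ℂ] K)) :
    A ⊗[ℂ] B →ₗ[ℂ] (HilbertTensor H K →L[ℂ] HilbertTensor H K) :=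
  TensorProduct.lift (opTensorBilin.compl₁₂ (π : A →ₗ[ℂ] (H →L[ℂ] H)) (ρ : B →ₗ[ℂ] (K →L[ℂ] K)))

theorem repTensorLinear_tmul (π : A →⋆ₐ[ℂ] (H →L[ℂ] H)) (ρ : B →⋆ₐ[ℂ] (K →L[ℂ] K)) (a : A) (b : B) :
    repTensorLinear π ρ (a ⊗ₜ b) = opTensor (π a) (ρ b) := rfl

theorem repTensorLinear_star (π : A →⋆ₐ[ℂ] (H →L[ℂ] H)) (ρ : B →⋆ₐ[ℂ] (K →L[ℂ] K))
    (x : A ⊗[ℂ] B) : repTensorLinear π ρ (star x) = star (repTensorLinear π ρ x) := by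
  induction x using TensorProduct.induction_on with
  | zero => simp
  | add a b ha hb => rw [star_add, map_add, map_add, star_add, ha, hb]
  | tmul a b =>
    rw [TensorProduct.star_tmul, repTensorLinear_tmul, repTensorLinear_tmul, ← opTensor_star,
      StarHomClass.map_star, StarHomClass.map_star]

/-- The tensor product representation `a ⊗ b ↦ π a ⊗ ρ b` of two representations. -/
noncomputable def repTensor (π : A →⋆ₐ[ℂ] (H →L[ℂ] H)) (ρ : B →⋆ₐ[ℂ] (K →L[ℂ] K)) :
    A ⊗[ℂ] B →⋆ₐ[ℂ] (HilbertTensor H K →L[ℂ] HilbertTensor H K) where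
  __ := Algebra.TensorProduct.algHomOfLinearMapTensorProduct (repTensorLinear π ρ)
    (fun a a' b b' => by
      rw [repTensorLinear_tmul, repTensorLinear_tmul, repTensorLinear_tmul, map_mul, map_mul,
        opTensor_mul])
    (by rw [repTensorLinear_tmul, map_one, map_one, opTensor_one])
  map_star' x := repTensorLinear_star π ρ x

theorem repTensor_tmul (π : A →⋆ₐ[ℂ] (H →L[ℂ] H)) (ρ : B →⋆ₐ[ℂ] (K →L[ℂ] K)) (a : A) (b : B) :
    repTensor π ρ (a ⊗ₜ b) = opTensor (π a) (ρ b) := rfl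

theorem norm_repTensor_tmul_le (π : A →⋆ₐ[ℂ] (H →L[ℂ] H)) (ρ : B →⋆ₐ[ℂ] (K →L[ℂ] K)) (a : A)
    (b : B) : ‖repTensor π ρ (a ⊗ₜ b)‖ ≤ ‖a‖ * ‖b‖ := by
  rw [repTensor_tmul]
  refine (norm_opTensor_le _ _).trans ?_
  gcongr
  · exact NonUnitalStarAlgHom.norm_apply_le π a
  · exact NonUnitalStarAlgHom.norm_apply_le ρ b
end reps

/-- The C*-seminorms `x ↦ ‖(π ⊗ ρ) x‖` for `π` and `ρ` ranging over the representations of `A` and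
of `B` on Hilbert spaces. -/
def tensorSeminorms (A : Type u) (B : Type v) [CStarAlgebra A] [CStarAlgebra B] :
    Set (CStarSeminorm (A ⊗[ℂ] B)) :=
  {p | ∃ (H : Type u) (_ : NormedAddCommGroup H) (_ : InnerProductSpace ℂ H) (_ : CompleteSpace H)
    (K : Type v) (_ : NormedAddCommGroup K) (_ : InnerProductSpace ℂ K) (_ : CompleteSpace K)
    (π : A →⋆ₐ[ℂ] (H →L[ℂ] H)) (ρ : B →⋆ₐ[ℂ] (K →L[ℂ] K)),
    p = CStarSeminorm.ofHom (repTensor π ρ)}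

theorem bddAbove_tensorSeminorms (x : A ⊗[ℂ] B) :
    BddAbove (Set.range fun p : tensorSeminorms A B => p.1 x) := by
  suffices h : ∃ C, ∀ p ∈ tensorSeminorms A B, p x ≤ C by
    obtain ⟨C, hC⟩ := h
    exact ⟨C, by rintro _ ⟨p, rfl⟩; exact hC p.1 p.2⟩
  induction x using TensorProduct.induction_on with
  | zero => exact ⟨0, fun p _ => (map_zero p).le⟩
  | add a b ha hb =>
    obtain ⟨C, hC⟩ := ha
    obtain ⟨D, hD⟩ := hb
    exact ⟨C + D, fun p hp => (map_add_le_add p a b).trans (add_le_add (hC p hp) (hD p hp))⟩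
  | tmul a b =>
    refine ⟨‖a‖ * ‖b‖, ?_⟩
    rintro _ ⟨H, _, _, _, K, _, _, _, π, ρ, rfl⟩
    exact norm_repTensor_tmul_le π ρ a b

/-- The minimal (spatial) C*-norm on the algebraic tensor product:
`‖x‖ = sup ‖(π ⊗ ρ) x‖` over all pairs of Hilbert space representations. -/
noncomputable def minTensorNorm (A : Type u) (B : Type v) [CStarAlgebra A] [CStarAlgebra B] :
    CStarSeminorm (A ⊗[ℂ] B) :=
  CStarSeminorm.sup (tensorSeminorms A B) bddAbove_tensorSeminorms

/-- The minimal (spatial) tensor product of two unital C*-algebras. -/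
abbrev MinTensor (A : Type u) (B : Type v) [CStarAlgebra A] [CStarAlgebra B] : Type (max u v) :=
  (minTensorNorm A B).Completion

namespace MinTensor

/-- `a ⊗ b`. -/
noncomputable def tmul (a : A) (b : B) : MinTensor A B :=
  (minTensorNorm A B).toCompletion (a ⊗ₜ b)

theorem tmul_mul_tmul (a a' : A) (b b' : B) :
    tmul a b * tmul a' b' = tmul (a * a') (b * b') := by
  rw [tmul, tmul, tmul, ← map_mul, Algebra.TensorProduct.tmul_mul_tmul]

theorem star_tmul (a : A) (b : B) : star (tmul a b) = tmul (star a) (star b) := by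
  rw [tmul, tmul, ← StarHomClass.map_star, TensorProduct.star_tmul]

theorem tmul_one_one : tmul (1 : A) (1 : B) = 1 := by
  rw [tmul, ← Algebra.TensorProduct.one_def, map_one]

theorem zero_tmul (b : B) : tmul (0 : A) b = 0 := by
  rw [tmul, TensorProduct.zero_tmul, map_zero]

theorem tmul_zero (a : A) : tmul a (0 : B) = 0 := by
  rw [tmul, TensorProduct.tmul_zero, map_zero]

theorem sum_tmul {ι : Type*} (s : Finset ι) (f : ι → A) (b : B) :
    tmul (∑ i ∈ s, f i) b = ∑ i ∈ s, tmul (f i) b := by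
  simp only [tmul, TensorProduct.sum_tmul, map_sum]

theorem tmul_sum {ι : Type*} (s : Finset ι) (a : A) (f : ι → B) :
    tmul a (∑ i ∈ s, f i) = ∑ i ∈ s, tmul a (f i) := by
  simp only [tmul, TensorProduct.tmul_sum, map_sum]

variable {A' : Type u} {B' : Type v} [CStarAlgebra A'] [CStarAlgebra B']

/-- The tensor product of two `*`-homomorphisms on the algebraic tensor product. -/
noncomputable def algMap (φ : A →⋆ₐ[ℂ] A') (ψ : B →⋆ₐ[ℂ] B') : A ⊗[ℂ] B →⋆ₐ[ℂ] A' ⊗[ℂ] B' where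
  __ := Algebra.TensorProduct.map (φ : A →ₐ[ℂ] A') (ψ : B →ₐ[ℂ] B')
  map_star' x := by
    change Algebra.TensorProduct.map (φ : A →ₐ[ℂ] A') (ψ : B →ₐ[ℂ] B') (star x) =
      star (Algebra.TensorProduct.map (φ : A →ₐ[ℂ] A') (ψ : B →ₐ[ℂ] B') x)
    induction x using TensorProduct.induction_on with
    | zero => simp
    | add a b ha hb => rw [star_add, map_add, map_add, star_add, ha, hb]
    | tmul a b => simp [StarHomClass.map_star]

theorem algMap_tmul (φ : A →⋆ₐ[ℂ] A') (ψ : B →⋆ₐ[ℂ] B') (a : A) (b : B) :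
    algMap φ ψ (a ⊗ₜ b) = φ a ⊗ₜ ψ b := rfl

theorem minTensorNorm_algMap_le (φ : A →⋆ₐ[ℂ] A') (ψ : B →⋆ₐ[ℂ] B') (x : A ⊗[ℂ] B) :
    minTensorNorm A' B' (algMap φ ψ x) ≤ minTensorNorm A B x := by
  refine CStarSeminorm.sup_le (apply_nonneg _ _) ?_
  rintro _ ⟨H, _, _, _, K, _, _, _, π, ρ, rfl⟩
  have h : repTensor π ρ (algMap φ ψ x) = repTensor (π.comp φ) (ρ.comp ψ) x := by
    induction x using TensorProduct.induction_on with
    | zero => simp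
    | add a b ha hb => rw [map_add, map_add, map_add, ha, hb]
    | tmul a b => rfl
  rw [CStarSeminorm.ofHom_apply, h]
  exact CStarSeminorm.le_sup (S := tensorSeminorms A B) (hS := bddAbove_tensorSeminorms)
    (p := CStarSeminorm.ofHom (repTensor (π.comp φ) (ρ.comp ψ)))
    ⟨H, _, _, _, K, _, _, _, _, _, rfl⟩ x

/-- The tensor product `φ ⊗ ψ` of two `*`-homomorphisms on the minimal tensor product. -/
noncomputable def map (φ : A →⋆ₐ[ℂ] A') (ψ : B →⋆ₐ[ℂ] B') : MinTensor A B →⋆ₐ[ℂ] MinTensor A' B' :=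
  CStarSeminorm.lift ((minTensorNorm A' B').toCompletion.comp (algMap φ ψ)) fun x => by
    rw [StarAlgHom.comp_apply, CStarSeminorm.norm_toCompletion]
    exact minTensorNorm_algMap_le φ ψ x

theorem map_tmul (φ : A →⋆ₐ[ℂ] A') (ψ : B →⋆ₐ[ℂ] B') (a : A) (b : B) :
    map φ ψ (tmul a b) = tmul (φ a) (ψ b) :=
  CStarSeminorm.lift_toCompletion _ _ _

end MinTensor
end tensor

/-! ### Universal C*-algebras on self-adjoint generators -/

section universalAlgebra

/-- The free unital complex `*`-algebra on a set `X` of self-adjoint generators. -/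
abbrev FreeStarAlgebra (X : Type u) : Type u := ℂ ⊗[ℝ] FreeAlgebra ℝ X

instance (X : Type u) : StarModule ℝ (FreeAlgebra ℝ X) where
  star_smul r a := by
    rw [Algebra.smul_def, star_mul, FreeAlgebra.star_algebraMap, ← Algebra.commutes,
      ← Algebra.smul_def, star_trivial r]

instance (X : Type u) : StarModule ℂ (FreeStarAlgebra X) where
  star_smul c a := by
    induction a using TensorProduct.induction_on with
    | zero => simp
    | add a b ha hb => rw [smul_add, star_add, ha, hb, star_add, smul_add]
    | tmul z a =>
      rw [TensorProduct.smul_tmul', TensorProduct.star_tmul, TensorProduct.star_tmul,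
        TensorProduct.smul_tmul', star_smul]

namespace FreeStarAlgebra
variable {X : Type u}

/-- The generators. -/
noncomputable def gen (x : X) : FreeStarAlgebra X := 1 ⊗ₜ FreeAlgebra.ι ℝ x

theorem star_gen (x : X) : star (gen x) = gen x := by
  rw [gen, TensorProduct.star_tmul, star_one, FreeAlgebra.star_ι]

variable {B : Type v} [CStarAlgebra B]

theorem star_lift_real (v : X → B) (hv : ∀ x, star (v x) = v x) (a : FreeAlgebra ℝ X) :
    FreeAlgebra.lift ℝ v (star a) = star (FreeAlgebra.lift ℝ v a) := by
  induction a using FreeAlgebra.induction with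
  | grade0 r =>
    rw [FreeAlgebra.star_algebraMap, AlgHom.commutes, IsScalarTower.algebraMap_apply ℝ ℂ B,
      ← algebraMap_star_comm]
    simp
  | grade1 x => rw [FreeAlgebra.star_ι, FreeAlgebra.lift_ι_apply, hv]
  | mul a b ha hb => rw [star_mul, map_mul, map_mul, star_mul, ha, hb]
  | add a b ha hb => rw [star_add, map_add, map_add, star_add, ha, hb]

/-- The `*`-homomorphism that sends the generators to given self-adjoint elements. -/
noncomputable def lift (v : X → B) (hv : ∀ x, star (v x) = v x) : FreeStarAlgebra X →⋆ₐ[ℂ] B where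
  __ := AlgHom.liftEquiv ℝ ℂ (FreeAlgebra ℝ X) B (FreeAlgebra.lift ℝ v)
  map_star' a := by
    change AlgHom.liftEquiv ℝ ℂ (FreeAlgebra ℝ X) B (FreeAlgebra.lift ℝ v) (star a) =
      star (AlgHom.liftEquiv ℝ ℂ (FreeAlgebra ℝ X) B (FreeAlgebra.lift ℝ v) a)
    induction a using TensorProduct.induction_on with
    | zero => simp
    | add a b ha hb => rw [star_add, map_add, map_add, star_add, ha, hb]
    | tmul z a =>
      rw [TensorProduct.star_tmul, AlgHom.liftEquiv_tmul, AlgHom.liftEquiv_tmul,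
        star_lift_real v hv, star_smul]

theorem lift_gen (v : X → B) (hv : ∀ x, star (v x) = v x) (x : X) : lift v hv (gen x) = v x := by
  change AlgHom.liftEquiv ℝ ℂ (FreeAlgebra ℝ X) B (FreeAlgebra.lift ℝ v) (gen x) = v x
  rw [gen, AlgHom.liftEquiv_tmul, one_smul, FreeAlgebra.lift_ι_apply]

theorem induction {P : FreeStarAlgebra X → Prop} (hs : ∀ c : ℂ, P (algebraMap ℂ _ c))
    (hg : ∀ x, P (gen x)) (ha : ∀ a b, P a → P b → P (a + b)) (hm : ∀ a b, P a → P b → P (a * b))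
    (a : FreeStarAlgebra X) : P a := by
  induction a using TensorProduct.induction_on with
  | zero => simpa using hs 0
  | add a b iha ihb => exact ha a b iha ihb
  | tmul z a =>
    have h : ∀ a : FreeAlgebra ℝ X, P ((1 : ℂ) ⊗ₜ a) := by
      intro a
      induction a using FreeAlgebra.induction with
      | grade0 r =>
        have := hs (r : ℂ)
        rwa [Algebra.TensorProduct.algebraMap_apply, Algebra.algebraMap_self_apply,
          show (r : ℂ) = r • (1 : ℂ) by simp, TensorProduct.smul_tmul,
          ← Algebra.algebraMap_eq_smul_one] at this
      | grade1 x => exact hg x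
      | mul a b ha hb =>
        have := hm _ _ ha hb
        rwa [Algebra.TensorProduct.tmul_mul_tmul, one_mul] at this
      | add a b iha ihb => rw [TensorProduct.tmul_add]; exact ha _ _ iha ihb
    have := hm _ _ (hs z) (h a)
    rwa [Algebra.TensorProduct.algebraMap_apply, Algebra.algebraMap_self_apply,
      Algebra.TensorProduct.tmul_mul_tmul, mul_one, one_mul] at this

end FreeStarAlgebra

/-- A set of relations on families of elements of C*-algebras indexed by `X`: a property of such
families which forces the elements to be self-adjoint contractions. -/
structure CStarRelations (X : Type u) where
  holds : ∀ {B : Type u} [CStarAlgebra B], (X → B) → Prop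
  star_eq : ∀ {B : Type u} [CStarAlgebra B] {v : X → B}, holds v → ∀ x, star (v x) = v x
  norm_le_one : ∀ {B : Type u} [CStarAlgebra B] {v : X → B}, holds v → ∀ x, ‖v x‖ ≤ 1

namespace CStarRelations
variable {X : Type u} (R : CStarRelations X)

/-- The C*-seminorms `a ↦ ‖a(v)‖` on the free `*`-algebra, for `v` ranging over all families in
C*-algebras that satisfy the relations. -/
def seminorms : Set (CStarSeminorm (FreeStarAlgebra X)) :=
  {p | ∃ (B : Type u) (_ : CStarAlgebra B) (v : X → B) (hv : R.holds v),
    p = CStarSeminorm.ofHom (FreeStarAlgebra.lift v (R.star_eq hv))}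

theorem bddAbove_seminorms (a : FreeStarAlgebra X) :
    BddAbove (Set.range fun p : R.seminorms => p.1 a) := by
  suffices h : ∃ C, ∀ p ∈ R.seminorms, p a ≤ C by
    obtain ⟨C, hC⟩ := h
    exact ⟨C, by rintro _ ⟨p, rfl⟩; exact hC p.1 p.2⟩
  induction a using FreeStarAlgebra.induction with
  | hs c =>
    refine ⟨‖c‖, ?_⟩
    rintro _ ⟨B, _, v, hv, rfl⟩
    rw [CStarSeminorm.ofHom_apply, AlgHomClass.commutes]
    rcases subsingleton_or_nontrivial B with h | h
    · rw [Subsingleton.elim (algebraMap ℂ B c) 0, norm_zero]; exact norm_nonneg c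
    · exact (norm_algebraMap' B c).le
  | hg x =>
    refine ⟨1, ?_⟩
    rintro _ ⟨B, _, v, hv, rfl⟩
    rw [CStarSeminorm.ofHom_apply, FreeStarAlgebra.lift_gen]
    exact R.norm_le_one hv x
  | ha a b ha hb =>
    obtain ⟨C, hC⟩ := ha
    obtain ⟨D, hD⟩ := hb
    exact ⟨C + D, fun p hp => (map_add_le_add p a b).trans (add_le_add (hC p hp) (hD p hp))⟩
  | hm a b ha hb =>
    obtain ⟨C, hC⟩ := ha
    obtain ⟨D, hD⟩ := hb
    exact ⟨C * D, fun p hp => (p.mul_le a b).trans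
      (mul_le_mul (hC p hp) (hD p hp) (apply_nonneg _ _) ((apply_nonneg _ _).trans (hC p hp)))⟩

/-- The universal C*-seminorm: the supremum of `‖a(v)‖` over all families `v` satisfying the
relations. -/
noncomputable def norm : CStarSeminorm (FreeStarAlgebra X) :=
  CStarSeminorm.sup R.seminorms R.bddAbove_seminorms

/-- The universal C*-algebra of the relations: the completion of the free `*`-algebra with respect to
the universal C*-seminorm. -/
abbrev Universal : Type u := R.norm.Completion

/-- The canonical generators of the universal C*-algebra. -/
noncomputable def gen (x : X) : R.Universal := R.norm.toCompletion (FreeStarAlgebra.gen x)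

theorem norm_lift_le {B : Type u} [CStarAlgebra B] {v : X → B} (hv : R.holds v)
    (a : FreeStarAlgebra X) : ‖FreeStarAlgebra.lift v (R.star_eq hv) a‖ ≤ R.norm a :=
  CStarSeminorm.le_sup (S := R.seminorms) (hS := R.bddAbove_seminorms)
    (p := CStarSeminorm.ofHom (FreeStarAlgebra.lift v (R.star_eq hv))) ⟨B, _, v, hv, rfl⟩ a

/-- The universal property: a family satisfying the relations is the image of the canonical
generators under a `*`-homomorphism. -/
noncomputable def lift {B : Type u} [CStarAlgebra B] {v : X → B} (hv : R.holds v) :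
    R.Universal →⋆ₐ[ℂ] B :=
  CStarSeminorm.lift (FreeStarAlgebra.lift v (R.star_eq hv)) (R.norm_lift_le hv)

theorem lift_gen {B : Type u} [CStarAlgebra B] {v : X → B} (hv : R.holds v) (x : X) :
    R.lift hv (R.gen x) = v x :=
  (CStarSeminorm.lift_toCompletion _ _ _).trans (FreeStarAlgebra.lift_gen v _ x)

theorem toCompletion_eq {a b : FreeStarAlgebra X}
    (h : ∀ {B : Type u} [CStarAlgebra B] {v : X → B} (hv : R.holds v),
      FreeStarAlgebra.lift v (R.star_eq hv) a = FreeStarAlgebra.lift v (R.star_eq hv) b) :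
    R.norm.toCompletion a = R.norm.toCompletion b := by
  rw [← sub_eq_zero, ← norm_eq_zero, ← map_sub, CStarSeminorm.norm_toCompletion]
  refine le_antisymm (CStarSeminorm.sup_le le_rfl ?_) (apply_nonneg _ _)
  rintro _ ⟨B, _, v, hv, rfl⟩
  rw [CStarSeminorm.ofHom_apply, map_sub, h hv, sub_self, norm_zero]

theorem star_gen (x : X) : star (R.gen x) = R.gen x := by
  rw [gen, ← StarHomClass.map_star, FreeStarAlgebra.star_gen]

theorem generates : (StarAlgebra.adjoin ℂ (Set.range R.gen)).topologicalClosure = ⊤ := by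
  rw [eq_top_iff]
  intro x _
  refine closure_mono ?_ (R.norm.denseRange_toCompletion x)
  rintro _ ⟨a, rfl⟩
  induction a using FreeStarAlgebra.induction with
  | hs c => rw [AlgHomClass.commutes]; exact algebraMap_mem _ c
  | hg x => exact StarAlgebra.subset_adjoin ℂ _ ⟨x, rfl⟩
  | ha a b ha hb => rw [map_add]; exact add_mem ha hb
  | hm a b ha hb => rw [map_mul]; exact mul_mem ha hb

end CStarRelations
end universalAlgebra

/-! ### Compact matrix quantum groups and quantum automorphism groups of colored graphs -/

section quantumGroups
open scoped Classical

/-- A compact matrix quantum group: a unital C*-algebra generated by the entries of a matrix `u`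
such that `u` and its transpose are invertible, with a `*`-homomorphism
`comul : u i j ↦ ∑ k, u i k ⊗ u k j` into the minimal tensor product. -/
structure CompactMatrixQuantumGroup (n : Type u) [Fintype n] where
  algebra : Type u
  [cstar : CStarAlgebra algebra]
  u : Matrix n n algebra
  generates : (StarAlgebra.adjoin ℂ
    (Set.range fun p : n × n => u p.1 p.2)).topologicalClosure = ⊤
  comul : algebra →⋆ₐ[ℂ] MinTensor algebra algebra
  comul_u : ∀ i j, comul (u i j) = ∑ k, MinTensor.tmul (u i k) (u k j)
  isUnit_u : IsUnit u
  isUnit_transpose : IsUnit u.transpose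

attribute [instance] CompactMatrixQuantumGroup.cstar

/-- Isomorphism of compact (matrix) quantum groups: there is a `*`-isomorphism `φ` of the
C*-algebras with `Δ ∘ φ = (φ ⊗ φ) ∘ Δ`. It need not respect the generating matrices. -/
def CompactMatrixQuantumGroup.Isomorphic {n m : Type u} [Fintype n] [Fintype m]
    (𝔾 : CompactMatrixQuantumGroup n) (ℍ : CompactMatrixQuantumGroup m) : Prop :=
  ∃ φ : 𝔾.algebra ≃⋆ₐ[ℂ] ℍ.algebra, ∀ a : 𝔾.algebra,
    ℍ.comul (φ a) =
      MinTensor.map (φ : 𝔾.algebra →⋆ₐ[ℂ] ℍ.algebra) (φ : 𝔾.algebra →⋆ₐ[ℂ] ℍ.algebra) (𝔾.comul a)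

/-- A magic unitary: the entries are projections and all rows and columns sum to `1`. -/
structure IsMagicUnitary {n : Type u} [Fintype n] {B : Type v} [Ring B] [StarRing B]
    (u : Matrix n n B) : Prop where
  star_eq : ∀ i j, star (u i j) = u i j
  mul_self : ∀ i j, u i j * u i j = u i j
  row_sum : ∀ i, ∑ l, u i l = 1
  col_sum : ∀ i, ∑ l, u l i = 1

theorem mul_eq_zero_of_sum_eq_one {n : Type u} [Fintype n] {B : Type v} [CStarAlgebra B]
    {p : n → B} (hs : ∀ i, star (p i) = p i) (hm : ∀ i, p i * p i = p i) (h1 : ∑ i, p i = 1)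
    {i j : n} (hij : i ≠ j) : p i * p j = 0 := by
  let _ := CStarAlgebra.spectralOrder B
  have _ := CStarAlgebra.spectralOrderedRing B
  have hpos : ∀ k ∈ Finset.univ.erase j, 0 ≤ star (p k * p j) * (p k * p j) :=
    fun k _ => star_mul_self_nonneg _
  have hterm : ∀ k, star (p k * p j) * (p k * p j) = p j * p k * p j := fun k => by
    rw [star_mul, hs, hs, mul_assoc, ← mul_assoc (p k), hm, mul_assoc]
  have hsum : ∑ k ∈ Finset.univ.erase j, star (p k * p j) * (p k * p j) = 0 := by
    have h2 : ∑ k, p j * p k * p j = p j := by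
      rw [← Finset.sum_mul, ← Finset.mul_sum, h1, mul_one, hm]
    rw [← Finset.add_sum_erase _ _ (Finset.mem_univ j), hm, hm] at h2
    simp only [hterm]
    exact add_eq_left.1 h2
  have := (Finset.sum_eq_zero_iff_of_nonneg hpos).1 hsum i (by simp [hij])
  exact CStarRing.star_mul_self_eq_zero_iff _ |>.1 this

namespace IsMagicUnitary
variable {n : Type u} [Fintype n]

section cstar
variable {B : Type v} [CStarAlgebra B] {u : Matrix n n B}

theorem row_orthogonal (h : IsMagicUnitary u) (i : n) {k l : n} (hkl : k ≠ l) :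
    u i k * u i l = 0 :=
  mul_eq_zero_of_sum_eq_one (p := u i) (h.star_eq i) (h.mul_self i) (h.row_sum i) hkl

theorem col_orthogonal (h : IsMagicUnitary u) (i : n) {k l : n} (hkl : k ≠ l) :
    u k i * u l i = 0 :=
  mul_eq_zero_of_sum_eq_one (p := fun k => u k i) (fun k => h.star_eq k i)
    (fun k => h.mul_self k i) (h.col_sum i) hkl

theorem norm_le_one (h : IsMagicUnitary u) (i j : n) : ‖u i j‖ ≤ 1 := by
  have h1 := CStarRing.norm_star_mul_self (x := u i j)
  rw [h.star_eq, h.mul_self] at h1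
  nlinarith [norm_nonneg (u i j)]

theorem mul_transpose (h : IsMagicUnitary u) : u * u.transpose = 1 := by
  ext i j
  rw [Matrix.mul_apply]
  simp only [Matrix.transpose_apply]
  by_cases hij : i = j
  · subst hij
    simp only [h.mul_self, h.row_sum, Matrix.one_apply_eq]
  · rw [Matrix.one_apply_ne hij]
    exact Finset.sum_eq_zero fun k _ => h.col_orthogonal k hij

theorem transpose_mul (h : IsMagicUnitary u) : u.transpose * u = 1 := by
  ext i j
  rw [Matrix.mul_apply]
  simp only [Matrix.transpose_apply]
  by_cases hij : i = j
  · subst hij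
    simp only [h.mul_self, h.col_sum, Matrix.one_apply_eq]
  · rw [Matrix.one_apply_ne hij]
    exact Finset.sum_eq_zero fun k _ => h.row_orthogonal k hij

theorem isUnit (h : IsMagicUnitary u) : IsUnit u :=
  ⟨⟨u, u.transpose, h.mul_transpose, h.transpose_mul⟩, rfl⟩

theorem isUnit_transpose (h : IsMagicUnitary u) : IsUnit u.transpose :=
  ⟨⟨u.transpose, u, h.transpose_mul, h.mul_transpose⟩, rfl⟩

/-- The matrix with entries `∑ k, u i k ⊗ u k j`. -/
noncomputable def _root_.comulMatrix {B : Type v} [CStarAlgebra B] (u : Matrix n n B) :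
    Matrix n n (MinTensor B B) :=
  fun i j => ∑ k, MinTensor.tmul (u i k) (u k j)

theorem comul (h : IsMagicUnitary u) : IsMagicUnitary (comulMatrix u) where
  star_eq i j := by
    simp only [comulMatrix, star_sum, MinTensor.star_tmul, h.star_eq]
  mul_self i j := by
    simp only [comulMatrix, Finset.sum_mul_sum, MinTensor.tmul_mul_tmul]
    refine Finset.sum_congr rfl fun k _ => ?_
    rw [Finset.sum_eq_single k, h.mul_self, h.mul_self]
    · intro l _ hl
      rw [h.row_orthogonal i hl.symm, MinTensor.zero_tmul]
    · simp
  row_sum i := by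
    simp only [comulMatrix]
    rw [Finset.sum_comm]
    simp only [← MinTensor.tmul_sum, h.row_sum]
    rw [← MinTensor.sum_tmul, h.row_sum, MinTensor.tmul_one_one]
  col_sum i := by
    simp only [comulMatrix]
    rw [Finset.sum_comm]
    simp only [← MinTensor.sum_tmul, h.col_sum]
    rw [← MinTensor.tmul_sum, h.col_sum, MinTensor.tmul_one_one]
end cstar
end IsMagicUnitary

section adjacency
variable {n : Type u} [Fintype n] {B : Type v} [CStarAlgebra B] {u : Matrix n n B}

/-- `u A_G = A_G u`, where `A_G` is the adjacency matrix of `G`. -/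
def CommutesWithAdj {B : Type v} [Ring B] (G : SimpleGraph n) (u : Matrix n n B) : Prop :=
  G.adjMatrix B * u = u * G.adjMatrix B

/-- `u A_G = A_G u`, entrywise. -/
theorem commutesWithAdj_iff {B : Type v} [Ring B] (G : SimpleGraph n) (u : Matrix n n B) :
    CommutesWithAdj G u ↔
      ∀ i j, ∑ k, (if G.Adj i k then u k j else 0) = ∑ k, (if G.Adj k j then u i k else 0) := by
  rw [CommutesWithAdj, ← Matrix.ext_iff]
  simp [Matrix.mul_apply, SimpleGraph.adjMatrix_apply]

theorem IsMagicUnitary.mul_eq_zero_of_adj (h : IsMagicUnitary u) {G : SimpleGraph n}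
    (hG : CommutesWithAdj G u) {i j a b : n} (hij : G.Adj i j)
    (hab : ¬ G.Adj a b) : u i a * u j b = 0 := by
  have h1 := congrArg (fun x => u i a * x * u j b) ((commutesWithAdj_iff G u).1 hG i b)
  simp only [Finset.mul_sum, Finset.sum_mul] at h1
  rw [Finset.sum_eq_single j, Finset.sum_eq_zero, if_pos hij, mul_assoc, h.mul_self] at h1
  · exact h1
  · intro k _
    split_ifs with hk
    · rw [h.row_orthogonal i (fun hak => hab (by rwa [hak])), zero_mul]
    · rw [mul_zero, zero_mul]
  · intro k _ hk
    split_ifs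
    · rw [mul_assoc, h.col_orthogonal b hk, mul_zero]
    · rw [mul_zero, zero_mul]
  · simp

theorem CommutesWithAdj.comul {G : SimpleGraph n} (hG : CommutesWithAdj G u) :
    CommutesWithAdj G (comulMatrix u) := by
  rw [commutesWithAdj_iff] at hG ⊢
  intro i j
  have hl : ∀ k, (if G.Adj i k then comulMatrix u k j else 0) =
      ∑ l, MinTensor.tmul (if G.Adj i k then u k l else 0) (u l j) := fun k => by
    split_ifs <;> simp [comulMatrix, MinTensor.zero_tmul]
  have hr : ∀ k, (if G.Adj k j then comulMatrix u i k else 0) =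
      ∑ l, MinTensor.tmul (u i l) (if G.Adj k j then u l k else 0) := fun k => by
    split_ifs <;> simp [comulMatrix, MinTensor.tmul_zero]
  simp only [hl, hr]
  calc ∑ k, ∑ l, MinTensor.tmul (if G.Adj i k then u k l else 0) (u l j)
      = ∑ l, MinTensor.tmul (∑ k, if G.Adj i k then u k l else 0) (u l j) := by
        rw [Finset.sum_comm]
        exact Finset.sum_congr rfl fun l _ => (MinTensor.sum_tmul _ _ _).symm
    _ = ∑ l, ∑ k, MinTensor.tmul (if G.Adj k l then u i k else 0) (u l j) :=
        Finset.sum_congr rfl fun l _ => by rw [hG, MinTensor.sum_tmul]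
    _ = ∑ l, ∑ k, MinTensor.tmul (u i l) (if G.Adj l k then u k j else 0) := by
        rw [Finset.sum_comm]
        refine Finset.sum_congr rfl fun k _ => Finset.sum_congr rfl fun l _ => ?_
        split_ifs
        · rfl
        · rw [MinTensor.zero_tmul, MinTensor.tmul_zero]
    _ = ∑ l, MinTensor.tmul (u i l) (∑ k, if G.Adj k j then u l k else 0) :=
        Finset.sum_congr rfl fun l _ => by rw [← hG, MinTensor.tmul_sum]
    _ = _ := by
        rw [Finset.sum_comm]
        exact Finset.sum_congr rfl fun l _ => MinTensor.tmul_sum _ _ _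

end adjacency

variable {V : Type u} [Fintype V] {S : Type v} {T : Type w}

/-- The defining relations of the quantum automorphism group of a vertex- and edge-colored graph. -/
structure IsQutMatrix (G : SimpleGraph V) (c : V → S) (e : G.EdgeLabeling T)
    {B : Type w'} [Ring B] [StarRing B] (u : Matrix V V B) : Prop extends IsMagicUnitary u where
  vertexColor : ∀ i j, c i ≠ c j → u i j = 0
  edgeColor : ∀ t : T, CommutesWithAdj (e.labelGraph t) u

/-- The defining relations of `Qut*_{c₀}`. -/
structure IsQutStarMatrix (G : SimpleGraph V) (e : G.EdgeLabeling T) (c₀ : T)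
    {B : Type w'} [Ring B] [StarRing B] (u : Matrix V V B) : Prop extends IsMagicUnitary u where
  edgeColor : ∀ t : T, CommutesWithAdj (e.labelGraph t) u
  commute : ∀ i j k l (hij : G.Adj i j) (hkl : G.Adj k l), e.get i j hij = e.get k l hkl →
    e.get i j hij ≠ c₀ → u i k * u j l = u j l * u i k

theorem IsQutMatrix.comul {G : SimpleGraph V} {c : V → S} {e : G.EdgeLabeling T} {B : Type w'}
    [CStarAlgebra B] {u : Matrix V V B} (h : IsQutMatrix G c e u) :
    IsQutMatrix G c e (comulMatrix u) where
  toIsMagicUnitary := h.toIsMagicUnitary.comul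
  vertexColor i j hij := by
    refine Finset.sum_eq_zero fun k _ => ?_
    by_cases hik : c i = c k
    · rw [h.vertexColor k j (fun hkj => hij (hik.trans hkj)), MinTensor.tmul_zero]
    · rw [h.vertexColor i k hik, MinTensor.zero_tmul]
  edgeColor t := (h.edgeColor t).comul

theorem IsQutStarMatrix.comul {G : SimpleGraph V} {e : G.EdgeLabeling T} {c₀ : T} {B : Type w'}
    [CStarAlgebra B] {u : Matrix V V B} (h : IsQutStarMatrix G e c₀ u) :
    IsQutStarMatrix G e c₀ (comulMatrix u) where
  toIsMagicUnitary := h.toIsMagicUnitary.comul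
  edgeColor t := (h.edgeColor t).comul
  commute i j k l hij hkl heq hne := by
    simp only [comulMatrix, Finset.sum_mul_sum, MinTensor.tmul_mul_tmul]
    rw [Finset.sum_comm]
    refine Finset.sum_congr rfl fun b _ => Finset.sum_congr rfl fun a _ => ?_
    have hadj : (e.labelGraph (e.get i j hij)).Adj i j :=
      (SimpleGraph.EdgeLabeling.labelGraph_adj i j).2 ⟨hij, rfl⟩
    by_cases hab : (e.labelGraph (e.get i j hij)).Adj a b
    · obtain ⟨hab', hc⟩ := (SimpleGraph.EdgeLabeling.labelGraph_adj a b).1 hab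
      have hc' : e.get a b hab' = e.get i j hij := hc
      rw [h.commute i j a b hij hab' hc'.symm hne,
        h.commute a b k l hab' hkl (hc'.trans heq) (hc' ▸ hne)]
    · have h1 := h.mul_eq_zero_of_adj (h.edgeColor _) hadj hab
      have h2 := h.mul_eq_zero_of_adj (h.edgeColor _) hadj.symm (fun hba => hab hba.symm)
      rw [h1, h2, MinTensor.zero_tmul, MinTensor.zero_tmul]

section universal
variable {n : Type u} (R : CStarRelations (n × n))

/-- The matrix of canonical generators of a universal C*-algebra on generators `u i j`. -/
noncomputable def CStarRelations.genMatrix : Matrix n n R.Universal := fun i j => R.gen (i, j)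

/-- A C*-relation on an `n × n` family implies that the generators form a magic unitary as soon
as every family that satisfies it does. -/
theorem CStarRelations.isMagicUnitary_genMatrix [Fintype n]
    (hR : ∀ {B : Type u} [CStarAlgebra B] {v : n × n → B}, R.holds v →
      IsMagicUnitary (fun i j => v (i, j))) : IsMagicUnitary R.genMatrix where
  star_eq i j := R.star_gen (i, j)
  mul_self i j := by
    rw [genMatrix, gen, ← map_mul]
    exact R.toCompletion_eq fun hv => by
      rw [map_mul, FreeStarAlgebra.lift_gen]; exact (hR hv).mul_self i j
  row_sum i := by
    simp only [genMatrix, gen]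
    rw [← map_sum, ← map_one R.norm.toCompletion]
    exact R.toCompletion_eq fun hv => by
      simp only [map_sum, map_one, FreeStarAlgebra.lift_gen]; exact (hR hv).row_sum i
  col_sum i := by
    simp only [genMatrix, gen]
    rw [← map_sum, ← map_one R.norm.toCompletion]
    exact R.toCompletion_eq fun hv => by
      simp only [map_sum, map_one, FreeStarAlgebra.lift_gen]; exact (hR hv).col_sum i

theorem CStarRelations.commutesWithAdj_genMatrix [Fintype n] (G : SimpleGraph n)
    (hR : ∀ {B : Type u} [CStarAlgebra B] {v : n × n → B}, R.holds v →
      CommutesWithAdj G (fun i j => v (i, j))) : CommutesWithAdj G R.genMatrix := by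
  rw [commutesWithAdj_iff]
  intro i j
  have h (P : Prop) (x : n × n) : (if P then R.gen x else 0) =
      R.norm.toCompletion (if P then FreeStarAlgebra.gen x else 0) := by
    split_ifs
    · rfl
    · rw [map_zero]
  simp only [genMatrix, h]
  rw [← map_sum, ← map_sum]
  exact R.toCompletion_eq fun hv => by
    have := (commutesWithAdj_iff G _).1 (hR hv) i j
    simpa only [map_sum, apply_ite (FreeStarAlgebra.lift _ (R.star_eq hv)),
      FreeStarAlgebra.lift_gen, map_zero] using this

end universal

section qut
variable (G : SimpleGraph V) (c : V → S) (e : G.EdgeLabeling T) (c₀ : T)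

/-- The relations of `C(Qut(G))`. -/
def qutRelations : CStarRelations (V × V) where
  holds v := IsQutMatrix G c e (fun i j => v (i, j))
  star_eq h x := h.star_eq x.1 x.2
  norm_le_one h x := h.toIsMagicUnitary.norm_le_one x.1 x.2

/-- The relations of `C(Qut*_{c₀}(G))`. -/
def qutStarRelations : CStarRelations (V × V) where
  holds v := IsQutStarMatrix G e c₀ (fun i j => v (i, j))
  star_eq h x := h.star_eq x.1 x.2
  norm_le_one h x := h.toIsMagicUnitary.norm_le_one x.1 x.2

theorem isQutMatrix_genMatrix : IsQutMatrix G c e (qutRelations G c e).genMatrix where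
  toIsMagicUnitary :=
    (qutRelations G c e).isMagicUnitary_genMatrix fun h => IsQutMatrix.toIsMagicUnitary h
  vertexColor i j hij := by
    rw [CStarRelations.genMatrix, CStarRelations.gen,
      ← map_zero (qutRelations G c e).norm.toCompletion]
    exact (qutRelations G c e).toCompletion_eq fun hv => by
      rw [map_zero, FreeStarAlgebra.lift_gen]; exact IsQutMatrix.vertexColor hv i j hij
  edgeColor t :=
    (qutRelations G c e).commutesWithAdj_genMatrix _ fun h => IsQutMatrix.edgeColor h t

theorem isQutStarMatrix_genMatrix :
    IsQutStarMatrix G e c₀ (qutStarRelations G e c₀).genMatrix where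
  toIsMagicUnitary :=
    (qutStarRelations G e c₀).isMagicUnitary_genMatrix fun h => IsQutStarMatrix.toIsMagicUnitary h
  edgeColor t :=
    (qutStarRelations G e c₀).commutesWithAdj_genMatrix _ fun h => IsQutStarMatrix.edgeColor h t
  commute i j k l hij hkl heq hne := by
    simp only [CStarRelations.genMatrix, CStarRelations.gen]
    rw [← map_mul, ← map_mul]
    exact (qutStarRelations G e c₀).toCompletion_eq fun hv => by
      simp only [map_mul, FreeStarAlgebra.lift_gen]
      exact IsQutStarMatrix.commute hv i j k l hij hkl heq hne

/-- The quantum automorphism group `Qut(G)` of a graph `G` with vertex-coloring `c` and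
edge-coloring `e`: its C*-algebra is the universal C*-algebra generated by the entries of a magic
unitary `u` with `u i j = 0` whenever `c i ≠ c j` and which commutes with the adjacency matrix of
every color class of edges; its comultiplication is `u i j ↦ ∑ k, u i k ⊗ u k j`. -/
noncomputable def qut : CompactMatrixQuantumGroup V where
  algebra := (qutRelations G c e).Universal
  u := (qutRelations G c e).genMatrix
  generates := (qutRelations G c e).generates
  comul := (qutRelations G c e).lift
    (v := fun p => comulMatrix (qutRelations G c e).genMatrix p.1 p.2)
    (isQutMatrix_genMatrix G c e).comul
  comul_u i j := CStarRelations.lift_gen _ _ (i, j)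
  isUnit_u := (isQutMatrix_genMatrix G c e).isUnit
  isUnit_transpose := (isQutMatrix_genMatrix G c e).isUnit_transpose

/-- The compact matrix quantum group `Qut*_{c₀}(G)` of an edge-colored graph `G`: its C*-algebra
is the universal C*-algebra generated by the entries of a magic unitary `x` which commutes with the
adjacency matrix of every color class of edges and satisfies `x i k * x j l = x j l * x i k`
whenever `(i, j)` and `(k, l)` are edges of the same color, different from `c₀`; its
comultiplication is `x i j ↦ ∑ k, x i k ⊗ x k j`. -/
noncomputable def qutStar : CompactMatrixQuantumGroup V where
  algebra := (qutStarRelations G e c₀).Universal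
  u := (qutStarRelations G e c₀).genMatrix
  generates := (qutStarRelations G e c₀).generates
  comul := (qutStarRelations G e c₀).lift
    (v := fun p => comulMatrix (qutStarRelations G e c₀).genMatrix p.1 p.2)
    (isQutStarMatrix_genMatrix G e c₀).comul
  comul_u i j := CStarRelations.lift_gen _ _ (i, j)
  isUnit_u := (isQutStarMatrix_genMatrix G e c₀).isUnit
  isUnit_transpose := (isQutStarMatrix_genMatrix G e c₀).isUnit_transpose

end qut
end quantumGroups

/-! ### The decolored graphs -/

section graphs
variable {V : Type u} {S : Type v} {T : Type w}

/-- The vertex set of the vertex-decolored graph: the vertex `⟨v, 0⟩` is the vertex `v` of `G`, and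
`⟨v, 0⟩, ⟨v, 1⟩, …, ⟨v, n (c v)⟩` is the path of length `n (c v)` attached to it. -/
abbrev VertexDecolored (c : V → S) (n : S → ℕ) : Type u := Σ v : V, Fin (n (c v) + 1)

/-- The graph obtained from `G` by attaching to every vertex `v` a path of length `n (c v)`. -/
def vertexDecolor (G : SimpleGraph V) (c : V → S) (n : S → ℕ) :
    SimpleGraph (VertexDecolored c n) where
  Adj x y := (x.2.val = 0 ∧ y.2.val = 0 ∧ G.Adj x.1 y.1) ∨
    (x.1 = y.1 ∧ (x.2.val + 1 = y.2.val ∨ y.2.val + 1 = x.2.val))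
  symm := ⟨fun x y h => by
    rcases h with ⟨h1, h2, h3⟩ | ⟨h1, h2⟩
    · exact Or.inl ⟨h2, h1, h3.symm⟩
    · exact Or.inr ⟨h1.symm, h2.symm⟩⟩
  loopless := ⟨fun x h => by
    rcases h with ⟨_, _, h⟩ | ⟨_, h⟩
    · exact h.ne rfl
    · omega⟩

open scoped Classical in
/-- The edge-coloring of `vertexDecolor G c n`: the edges of `G` keep their color, the edges of the
attached paths get the color `c₀`. -/
noncomputable def vertexDecolorLabel (G : SimpleGraph V) (c : V → S) (n : S → ℕ)
    (e : G.EdgeLabeling T) (c₀ : T) : (vertexDecolor G c n).EdgeLabeling T :=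
  SimpleGraph.EdgeLabeling.mk
    (fun x y _ => if h : G.Adj x.1 y.1 then e.get x.1 y.1 h else c₀)
    (fun x y _ => by
      by_cases h : G.Adj x.1 y.1
      · rw [dif_pos h, dif_pos h.symm]; exact e.get_comm x.1 y.1 h.symm
      · rw [dif_neg h, dif_neg fun h' => h h'.symm])

/-- The vertex set of the edge-decolored graph: the vertices of `H` and, for each edge `f` of color
different from `c₀`, the vertex `⟨f, 0⟩` that subdivides `f` and the further vertices
`⟨f, 1⟩, …, ⟨f, m (e f)⟩` of a path of length `m (e f)` starting at it. -/
abbrev EdgeDecolored {W : Type u} (H : SimpleGraph W) (e : H.EdgeLabeling T) (c₀ : T) (m : T → ℕ) :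
    Type u :=
  W ⊕ (Σ f : {f : H.edgeSet // e f ≠ c₀}, Fin (m (e f.1) + 1))

/-- The graph obtained from the edge-colored graph `H` by subdividing every edge `f` of color
different from `c₀`, attaching a path of length `m (e f)` to the subdividing vertex and forgetting
the colors. -/
def edgeDecolor {W : Type u} (H : SimpleGraph W) (e : H.EdgeLabeling T) (c₀ : T) (m : T → ℕ) :
    SimpleGraph (EdgeDecolored H e c₀ m) where
  Adj
    | .inl x, .inl y => ∃ h : H.Adj x y, e.get x y h = c₀
    | .inl x, .inr ⟨f, i⟩ => x ∈ (f.1 : Sym2 W) ∧ i.val = 0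
    | .inr ⟨f, i⟩, .inl x => x ∈ (f.1 : Sym2 W) ∧ i.val = 0
    | .inr ⟨f, i⟩, .inr ⟨g, j⟩ => f = g ∧ (i.val + 1 = j.val ∨ j.val + 1 = i.val)
  symm := ⟨by
    rintro (x | ⟨f, i⟩) (y | ⟨g, j⟩) h
    · exact ⟨h.1.symm, (e.get_comm x y h.1.symm).trans h.2⟩
    · exact h
    · exact h
    · exact ⟨h.1.symm, h.2.symm⟩⟩
  loopless := ⟨by
    rintro (x | ⟨f, i⟩) h
    · exact h.1.ne rfl
    · have := h.2; omega⟩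

open scoped Classical in
noncomputable instance {W : Type u} [Fintype W] (H : SimpleGraph W) (e : H.EdgeLabeling T) (c₀ : T)
    (m : T → ℕ) : Fintype (EdgeDecolored H e c₀ m) :=
  inferInstanceAs
    (Fintype (W ⊕ (Σ f : {f : H.edgeSet // e f ≠ c₀}, Fin (m (e f.1) + 1))))

end graphs

/-! ### Isomorphisms of compact quantum groups from generating matrices -/

section isomorphisms

/-! The hypothesis is the middle link of the chain Qut(G'') ≅ Qut*(G') ≅ Qut(G') ≅ Qut(G). The outer
links, `qutStar_isomorphic_qut_edgeDecolor` and `qut_isomorphic_qut_vertexDecolor`, hold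
unconditionally once degrees are at least 3, respectively 2.

Both follow one pattern, isolated in `isomorphic_of_block`. The generating matrix of the larger
graph is block diagonal, its block on the original vertices satisfies the relations of the smaller
object, and all its other entries are determined by this block. Conversely, any matrix for the
smaller object extends by the same formulas to one for the larger graph. The universal properties
then give mutually inverse homomorphisms.

Block diagonality comes from combinatorial invariants. If a magic unitary `u` commutes with the
adjacency matrix, then `u i j = 0` unless `i` and `j` have the same number of neighbors in each
invariant set (`Preserves.ncard_adj`). Starting from degrees, the pendant paths are peeled off from
their free ends, which recovers positions and path lengths, hence the forgotten colors. In G'' the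
subdividing vertices are base vertices of paths too; they have exactly two base neighbors, while
original vertices have at least three. This is where degree 3 is needed.

The entries of `u` are constant along paths. An entry between the vertices subdividing the edges
{i,j} and {k,l} equals `u_ik u_jl + u_il u_jk` (`apply_mid_mid`). Exchanging the names of the ends
in both edges reverses the order of the factors, and orthogonality then forces `u_ik` and `u_jl` to
commute: this is exactly the extra relation of Qut*. Conversely, that commutation makes the same
formula well defined, self-adjoint and idempotent, so it extends a Qut* matrix to the subdivided
graph. -/

theorem StarAlgHom.ext_of_topologicalClosure_adjoin {A B : Type*} [CStarAlgebra A] [CStarAlgebra B]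
    {s : Set A} (hs : (StarAlgebra.adjoin ℂ s).topologicalClosure = ⊤) {f g : A →⋆ₐ[ℂ] B}
    (h : ∀ a ∈ s, f a = g a) : f = g := by
  have hf : Continuous f := AddMonoidHomClass.continuous_of_bound f 1 fun a => by
    rw [one_mul]; exact NonUnitalStarAlgHom.norm_apply_le f a
  have hg : Continuous g := AddMonoidHomClass.continuous_of_bound g 1 fun a => by
    rw [one_mul]; exact NonUnitalStarAlgHom.norm_apply_le g a
  refine DFunLike.ext _ _ fun x => ?_
  have hx : x ∈ (StarAlgebra.adjoin ℂ s).topologicalClosure := hs ▸ trivial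
  refine closure_minimal (s := (StarAlgebra.adjoin ℂ s : Set A)) (t := {x | f x = g x})
    (fun y hy => ?_) (isClosed_eq hf hg) hx
  induction hy using StarAlgebra.adjoin_induction with
  | mem a ha => exact h a ha
  | algebraMap c => exact (AlgHomClass.commutes f c).trans (AlgHomClass.commutes g c).symm
  | add a b _ _ ha hb =>
    exact (map_add f a b).trans ((congrArg₂ (· + ·) ha hb).trans (map_add g a b).symm)
  | mul a b _ _ ha hb =>
    exact (map_mul f a b).trans ((congrArg₂ (· * ·) ha hb).trans (map_mul g a b).symm)
  | star a _ ha =>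
    exact (StarHomClass.map_star f a).trans ((congrArg star ha).trans
      (StarHomClass.map_star g a).symm)

namespace MinTensor
variable {A A' A'' : Type u} {B B' B'' : Type v} [CStarAlgebra A] [CStarAlgebra B]
  [CStarAlgebra A'] [CStarAlgebra B'] [CStarAlgebra A''] [CStarAlgebra B'']

theorem hom_ext {C : Type*} [CStarAlgebra C] {f g : MinTensor A B →⋆ₐ[ℂ] C}
    (h : ∀ a b, f (tmul a b) = g (tmul a b)) : f = g := by
  have hf : Continuous f := AddMonoidHomClass.continuous_of_bound f 1 fun a => by
    rw [one_mul]; exact NonUnitalStarAlgHom.norm_apply_le f a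
  have hg : Continuous g := AddMonoidHomClass.continuous_of_bound g 1 fun a => by
    rw [one_mul]; exact NonUnitalStarAlgHom.norm_apply_le g a
  refine DFunLike.ext _ _ fun x => (minTensorNorm A B).induction_on (P := fun x => f x = g x) x
    (isClosed_eq hf hg) fun t => ?_
  change f ((minTensorNorm A B).toCompletion t) = g ((minTensorNorm A B).toCompletion t)
  induction t using TensorProduct.induction_on with
  | zero => simp
  | add a b ha hb => rw [map_add, map_add, map_add, ha, hb]
  | tmul a b => exact h a b

theorem map_map (φ : A →⋆ₐ[ℂ] A') (ψ : B →⋆ₐ[ℂ] B') (φ' : A' →⋆ₐ[ℂ] A'') (ψ' : B' →⋆ₐ[ℂ] B'')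
    (x : MinTensor A B) : map φ' ψ' (map φ ψ x) = map (φ'.comp φ) (ψ'.comp ψ) x := by
  have h : (map φ' ψ').comp (map φ ψ) = map (φ'.comp φ) (ψ'.comp ψ) := hom_ext fun a b => by
    simp [map_tmul]
  exact DFunLike.congr_fun h x

theorem map_id (x : MinTensor A B) : map (.id ℂ A) (.id ℂ B) x = x := by
  have h : map (.id ℂ A) (.id ℂ B) = .id ℂ (MinTensor A B) := hom_ext fun a b => by
    simp [map_tmul]
  exact DFunLike.congr_fun h x

end MinTensor

namespace CompactMatrixQuantumGroup
variable {n m k : Type u} [Fintype n] [Fintype m] [Fintype k] {𝔾 : CompactMatrixQuantumGroup n}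
  {ℍ : CompactMatrixQuantumGroup m} {𝕂 : CompactMatrixQuantumGroup k}

theorem Isomorphic.symm (h : 𝔾.Isomorphic ℍ) : ℍ.Isomorphic 𝔾 := by
  obtain ⟨φ, h⟩ := h
  refine ⟨φ.symm, fun a => ?_⟩
  have hc : (φ.symm : ℍ.algebra →⋆ₐ[ℂ] 𝔾.algebra).comp (φ : 𝔾.algebra →⋆ₐ[ℂ] ℍ.algebra) =
      .id ℂ _ := DFunLike.ext _ _ fun x => φ.symm_apply_apply x
  have := h (φ.symm a)
  rw [φ.apply_symm_apply] at this
  rw [this, MinTensor.map_map, hc, MinTensor.map_id]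

theorem Isomorphic.trans (h : 𝔾.Isomorphic ℍ) (h' : ℍ.Isomorphic 𝕂) : 𝔾.Isomorphic 𝕂 := by
  obtain ⟨φ, h⟩ := h
  obtain ⟨ψ, h'⟩ := h'
  refine ⟨φ.trans ψ, fun a => ?_⟩
  have := h' (φ a)
  rw [h, MinTensor.map_map] at this
  exact this

/-- A `*`-isomorphism that identifies the generating matrix of `𝔾` with a diagonal block of the
generating matrix of `ℍ` is an isomorphism of compact quantum groups. -/
theorem isomorphic_of_block (Φ : 𝔾.algebra →⋆ₐ[ℂ] ℍ.algebra) (Ψ : ℍ.algebra →⋆ₐ[ℂ] 𝔾.algebra)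
    (ι : n → m) (hι : Function.Injective ι) (hΦ : ∀ i j, Φ (𝔾.u i j) = ℍ.u (ι i) (ι j))
    (hΨ : ∀ i j, Ψ (ℍ.u (ι i) (ι j)) = 𝔾.u i j) (hΦΨ : ∀ a b, Φ (Ψ (ℍ.u a b)) = ℍ.u a b)
    (hblock : ∀ i z, z ∉ Set.range ι → ℍ.u (ι i) z = 0) : 𝔾.Isomorphic ℍ := by
  have h1 : Ψ.comp Φ = .id ℂ _ :=
    StarAlgHom.ext_of_topologicalClosure_adjoin 𝔾.generates (by
      rintro _ ⟨p, rfl⟩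
      simp [hΦ, hΨ])
  have h2 : Φ.comp Ψ = .id ℂ _ :=
    StarAlgHom.ext_of_topologicalClosure_adjoin ℍ.generates (by
      rintro _ ⟨p, rfl⟩
      simp [hΦΨ])
  have h3 : ℍ.comul.comp Φ = (MinTensor.map Φ Φ).comp 𝔾.comul :=
    StarAlgHom.ext_of_topologicalClosure_adjoin 𝔾.generates (by
      rintro _ ⟨p, rfl⟩
      simp only [StarAlgHom.comp_apply, hΦ, ℍ.comul_u, 𝔾.comul_u, map_sum, MinTensor.map_tmul]
      -- The comultiplication of `ℍ` sums over all of `m`; the summands outside the block have a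
      -- vanishing left factor.
      refine (Fintype.sum_of_injective ι hι _ _ (fun z hz => ?_) fun i => rfl).symm
      rw [hblock _ _ hz, MinTensor.zero_tmul])
  refine ⟨StarAlgEquiv.ofStarAlgHom Φ Ψ h1 h2, fun a => ?_⟩
  exact DFunLike.congr_fun h3 a

end CompactMatrixQuantumGroup
end isomorphisms

/-! ### Magic unitaries and the invariants they preserve -/

section magic
open scoped Classical
variable {n : Type u} [Fintype n]

section
variable {B : Type v} [CStarAlgebra B] {u : Matrix n n B}

theorem IsMagicUnitary.transpose (h : IsMagicUnitary u) : IsMagicUnitary u.transpose where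
  star_eq i j := h.star_eq j i
  mul_self i j := h.mul_self j i
  row_sum i := h.col_sum i
  col_sum i := h.row_sum i

/-- A magic unitary commutes with an adjacency matrix if its entries respect adjacency. -/
theorem IsMagicUnitary.commutesWithAdj (h : IsMagicUnitary u) {G : SimpleGraph n}
    (h1 : ∀ i j a b, G.Adj i j → ¬ G.Adj a b → u i a * u j b = 0)
    (h2 : ∀ i j a b, ¬ G.Adj i j → G.Adj a b → u i a * u j b = 0) : CommutesWithAdj G u := by
  rw [commutesWithAdj_iff]
  intro i b
  -- Inserting a row sum on the left and a column sum on the right turns both sides into the same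
  -- double sum over edges `(i, j)` and `(a, b)`.
  have hl : ∀ j, (if G.Adj i j then u j b else 0) =
      ∑ a, if G.Adj i j ∧ G.Adj a b then u i a * u j b else 0 := fun j => by
    by_cases hij : G.Adj i j
    · conv_lhs => rw [if_pos hij, ← one_mul (u j b), ← h.row_sum i, Finset.sum_mul]
      refine Finset.sum_congr rfl fun a _ => ?_
      by_cases hab : G.Adj a b
      · simp [hij, hab]
      · simp [hab, h1 _ _ _ _ hij hab]
    · simp [hij]
  have hr : ∀ a, (if G.Adj a b then u i a else 0) =
      ∑ j, if G.Adj i j ∧ G.Adj a b then u i a * u j b else 0 := fun a => by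
    by_cases hab : G.Adj a b
    · conv_lhs => rw [if_pos hab, ← mul_one (u i a), ← h.col_sum b, Finset.mul_sum]
      refine Finset.sum_congr rfl fun j _ => ?_
      by_cases hij : G.Adj i j
      · simp [hij, hab]
      · simp [hij, h2 _ _ _ _ hij hab]
    · simp [hab]
  simp only [hl, hr]
  exact Finset.sum_comm

/-- The transpose of `u` is again a magic unitary commuting with the symmetric adjacency matrix, so
the case with rows and columns exchanged applies. -/
theorem IsMagicUnitary.mul_eq_zero_of_adj' (h : IsMagicUnitary u) {G : SimpleGraph n}
    (hG : CommutesWithAdj G u) {i j a b : n} (hij : ¬ G.Adj i j)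
    (hab : G.Adj a b) : u i a * u j b = 0 := by
  refine h.transpose.mul_eq_zero_of_adj (G := G) ?_ hab hij
  rw [commutesWithAdj_iff] at hG ⊢
  intro i j
  simpa [G.adj_comm] using (hG j i).symm

theorem CommutesWithAdj.transpose {G : SimpleGraph n} (hG : CommutesWithAdj G u) :
    CommutesWithAdj G u.transpose := by
  rw [commutesWithAdj_iff] at hG ⊢
  intro i j
  simpa [G.adj_comm] using (hG j i).symm

/-- The adjacency matrix is the sum over the color classes, but the set of colors may be infinite;
orthogonality, checked on one pair of edges at a time, avoids that sum. -/
theorem commutesWithAdj_of_labelGraph {T : Type*} {G : SimpleGraph n} {e : G.EdgeLabeling T}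
    (h : IsMagicUnitary u) (he : ∀ t, CommutesWithAdj (e.labelGraph t) u) :
    CommutesWithAdj G u := by
  refine h.commutesWithAdj (fun i j a b hij hab => ?_) (fun i j a b hij hab => ?_)
  · refine h.mul_eq_zero_of_adj (he (e.get i j hij)) ?_ fun h => hab (e.labelGraph_le h)
    exact (SimpleGraph.EdgeLabeling.labelGraph_adj _ _).2 ⟨hij, rfl⟩
  · refine h.mul_eq_zero_of_adj' (he (e.get a b hab)) (fun h => hij (e.labelGraph_le h)) ?_
    exact (SimpleGraph.EdgeLabeling.labelGraph_adj _ _).2 ⟨hab, rfl⟩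

/-- The matrix `u` is block diagonal with respect to the partition into the fibres of `f`. -/
def Preserves {B : Type*} [Zero B] {α : Type*} (u : Matrix n n B) (f : n → α) : Prop :=
  ∀ i j, f i ≠ f j → u i j = 0

omit [Fintype n] in
-- Every later invariant is obtained this way: it is a function of invariants already known,
-- combined by `Preserves.prodMk` and `Preserves.pi`.
theorem Preserves.of_factor {α β : Type*} {f : n → α} {g : n → β} (hf : Preserves u f)
    (h : ∀ i j, f i = f j → g i = g j) : Preserves u g :=
  fun i j hij => hf i j fun h' => hij (h i j h')

omit [Fintype n] in
theorem Preserves.transpose {α : Type*} {f : n → α} (hf : Preserves u f) :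
    Preserves u.transpose f :=
  fun i j hij => hf j i hij.symm

omit [Fintype n] in
theorem Preserves.prodMk {α β : Type*} {f : n → α} {g : n → β} (hf : Preserves u f)
    (hg : Preserves u g) : Preserves u (fun i => (f i, g i)) := fun i j hij => by
  by_cases h : f i = f j
  · exact hg i j fun h' => hij (Prod.ext h h')
  · exact hf i j h

omit [Fintype n] in
theorem Preserves.pi {ι : Type*} {α : ι → Type*} {f : n → ∀ a, α a}
    (hf : ∀ a, Preserves u (fun i => f i a)) : Preserves u f := fun i j hij => by
  obtain ⟨a, ha⟩ := Function.ne_iff.1 hij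
  exact hf a i j ha

/-- The number of neighbors in an invariant set is an invariant. -/
theorem Preserves.ncard_adj (h : IsMagicUnitary u) {G : SimpleGraph n} (hG : CommutesWithAdj G u)
    {p : n → Prop} (hp : Preserves u p) :
    Preserves u (fun i => {k | G.Adj i k ∧ p k}.ncard) := by
  intro i j hij
  have hN (i : n) : (({k | G.Adj i k ∧ p k}.ncard : ℕ) : B) =
      ∑ k, if G.Adj i k ∧ p k then 1 else 0 := by
    rw [Finset.sum_boole, Set.ncard_eq_toFinset_card']
    congr 2
    ext; simp
  -- Write `p` also for the indicator vector of the set and `d = A p` for the vector of counts.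
  -- Invariance of the set means `u p = p`, so `u d = u A p = A u p = d`.
  have h1 : (({k | G.Adj i k ∧ p k}.ncard : ℕ) : B) =
      ∑ j, u i j * (({k | G.Adj j k ∧ p k}.ncard : ℕ) : B) := by
    have hcol : ∀ l, ∑ k, (if p k then u l k else 0) = if p l then 1 else 0 := fun l => by
      by_cases hl : p l
      · rw [if_pos hl, ← h.row_sum l]
        refine Finset.sum_congr rfl fun k _ => ?_
        by_cases hk : p k
        · rw [if_pos hk]
        · rw [if_neg hk, hp l k (by simp [hl, hk])]
      · rw [if_neg hl]
        refine Finset.sum_eq_zero fun k _ => ?_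
        by_cases hk : p k
        · rw [if_pos hk, hp l k (by simp [hl, hk])]
        · rw [if_neg hk]
    calc (({k | G.Adj i k ∧ p k}.ncard : ℕ) : B)
        = ∑ l, if G.Adj i l then ∑ k, (if p k then u l k else 0) else 0 := by
          rw [hN]
          refine Finset.sum_congr rfl fun l _ => ?_
          rw [hcol]
          by_cases h1 : G.Adj i l <;> by_cases h2 : p l <;> simp [h1, h2]
      _ = ∑ k, if p k then ∑ l, (if G.Adj i l then u l k else 0) else 0 := by
          have e1 : ∀ l, (if G.Adj i l then ∑ k, (if p k then u l k else 0) else 0) =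
              ∑ k, if G.Adj i l ∧ p k then u l k else 0 := fun l => by
            by_cases hl : G.Adj i l <;> simp [hl]
          have e2 : ∀ k, (if p k then ∑ l, (if G.Adj i l then u l k else 0) else 0) =
              ∑ l, if G.Adj i l ∧ p k then u l k else 0 := fun k => by
            by_cases hk : p k <;> simp [hk]
          simp only [e1, e2]
          exact Finset.sum_comm
      _ = ∑ k, if p k then ∑ l, (if G.Adj l k then u i l else 0) else 0 := by
          simp only [(commutesWithAdj_iff G u).1 hG]
      _ = _ := by
          have e2 : ∀ k, (if p k then ∑ l, (if G.Adj l k then u i l else 0) else 0) =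
              ∑ l, if G.Adj l k ∧ p k then u i l else 0 := fun k => by
            by_cases hk : p k <;> simp [hk]
          simp only [e2]
          rw [Finset.sum_comm]
          refine Finset.sum_congr rfl fun l _ => ?_
          rw [hN, Finset.mul_sum]
          simp
  -- Multiplying row `i` of `u d = d` by `u i j` on the right leaves only the term of index `j`, by
  -- row orthogonality.
  have h2 : (({k | G.Adj i k ∧ p k}.ncard : ℕ) : B) * u i j =
      (({k | G.Adj j k ∧ p k}.ncard : ℕ) : B) * u i j := by
    conv_lhs => rw [h1, Finset.sum_mul]
    rw [Finset.sum_eq_single j]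
    · rw [(Nat.cast_commute _ (u i j)).symm.eq, mul_assoc, h.mul_self]
    · intro k _ hk
      rw [mul_assoc, (Nat.cast_commute _ (u i j)).eq, ← mul_assoc, h.row_orthogonal i hk,
        zero_mul]
    · simp
  have h3 : (((({k | G.Adj i k ∧ p k}.ncard : ℕ) : ℂ) -
      (({k | G.Adj j k ∧ p k}.ncard : ℕ) : ℂ))) • u i j = 0 := by
    rw [sub_smul, Nat.cast_smul_eq_nsmul, Nat.cast_smul_eq_nsmul, nsmul_eq_mul, nsmul_eq_mul, h2,
      sub_self]
  refine (smul_eq_zero.1 h3).resolve_left fun h4 => hij ?_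
  exact_mod_cast sub_eq_zero.1 h4

/-! ### Diagonal blocks -/

variable {m : Type w} [Fintype m] {ι : m → n}

theorem IsMagicUnitary.submatrix (h : IsMagicUnitary u) (hι : Function.Injective ι)
    (hp : Preserves u (· ∈ Set.range ι)) : IsMagicUnitary (u.submatrix ι ι) where
  star_eq i j := h.star_eq _ _
  mul_self i j := h.mul_self _ _
  row_sum i := by
    rw [← h.row_sum (ι i)]
    exact Fintype.sum_of_injective ι hι _ _
      (fun z hz => hp _ _ (by simpa using hz)) fun _ => rfl
  col_sum i := by
    rw [← h.col_sum (ι i)]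
    exact Fintype.sum_of_injective ι hι _ _
      (fun z hz => hp _ _ (by simpa using hz)) fun _ => rfl

theorem CommutesWithAdj.submatrix {G : SimpleGraph n} (hG : CommutesWithAdj G u)
    (hι : Function.Injective ι) (hp : Preserves u (· ∈ Set.range ι)) :
    CommutesWithAdj (G.comap ι) (u.submatrix ι ι) := by
  rw [commutesWithAdj_iff] at hG ⊢
  intro i j
  refine Eq.trans ?_ ((hG (ι i) (ι j)).trans ?_)
  · refine Fintype.sum_of_injective ι hι _ _ (fun z hz => ?_) fun _ => rfl
    rw [hp z (ι j) (by simpa using hz), ite_self]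
  · refine (Fintype.sum_of_injective ι hι _ _ (fun z hz => ?_) fun _ => rfl).symm
    rw [hp (ι i) z (by simpa using hz), ite_self]

end

/-! ### Graphs with pendant paths -/

/-- A graph which arises from a graph of minimal degree at least `2` by attaching to every vertex a
path. The number `pos x` is the position of `x` on its path, `len x` the length of this path. -/
structure HasPendantPaths (G : SimpleGraph n) (pos len : n → ℕ) : Prop where
  pos_le : ∀ x, pos x ≤ len x
  adj : ∀ {x y}, G.Adj x y → pos y ≠ 0 →
    (pos x + 1 = pos y ∨ pos y + 1 = pos x) ∧ len x = len y
  exists_pred : ∀ x, pos x ≠ 0 → ∃ y, G.Adj x y ∧ pos y + 1 = pos x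
  exists_succ : ∀ x, pos x < len x → ∃ y, G.Adj x y ∧ pos y = pos x + 1
  unique : ∀ {x y z}, G.Adj x y → G.Adj x z → pos y = pos z → pos x ≠ 0 ∨ pos y ≠ 0 → y = z
  two_le : ∀ x, pos x = 0 → 2 ≤ {y | G.Adj x y ∧ pos y = 0}.ncard

namespace HasPendantPaths
variable {G : SimpleGraph n} {pos len : n → ℕ} (hP : HasPendantPaths G pos len)
include hP

omit [Fintype n] in
-- A neighbor of the free end can only be one step further in or one step further out, and the
-- latter would exceed the length of the path.
theorem ncard_adj_of_pos_eq_len {x : n} (h0 : pos x ≠ 0) (h : pos x = len x) :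
    {y | G.Adj x y}.ncard = 1 := by
  obtain ⟨y, hy, hyx⟩ := hP.exists_pred x h0
  rw [Set.ncard_eq_one]
  refine ⟨y, Set.ext fun z => ⟨fun hz => ?_, fun hz => ?_⟩⟩
  · have h1 := hP.adj (G.adj_symm hz) h0
    have h2 := hP.pos_le z
    exact hP.unique hz hy (by omega) (Or.inl h0)
  · rw [Set.mem_singleton_iff.1 hz]; exact hy

omit [Fintype n] in
theorem ncard_adj_of_pos_lt_len {x : n} (h0 : pos x ≠ 0) (h : pos x < len x) :
    {y | G.Adj x y}.ncard = 2 := by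
  obtain ⟨y, hy, hyx⟩ := hP.exists_pred x h0
  obtain ⟨y', hy', hyx'⟩ := hP.exists_succ x h
  rw [Set.ncard_eq_two]
  refine ⟨y, y', fun h => by subst h; omega, Set.ext fun z => ⟨fun hz => ?_, fun hz => ?_⟩⟩
  · rcases (hP.adj (G.adj_symm hz) h0).1 with h1 | h1
    · exact Or.inl (hP.unique hz hy (by omega) (Or.inl h0))
    · exact Or.inr (hP.unique hz hy' (by omega) (Or.inl h0))
  · rcases hz with rfl | rfl
    exacts [hy, hy']

theorem two_le_ncard_adj {x : n} (h0 : pos x = 0) : 2 ≤ {y | G.Adj x y}.ncard :=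
  (hP.two_le x h0).trans (Set.ncard_le_ncard fun _ h => h.1)

theorem three_le_ncard_adj {x : n} (h0 : pos x = 0) (h : len x ≠ 0) :
    3 ≤ {y | G.Adj x y}.ncard := by
  obtain ⟨y, hy, hyx⟩ := hP.exists_succ x (by omega)
  have h1 : insert y {y | G.Adj x y ∧ pos y = 0} ⊆ {y | G.Adj x y} := by
    rintro z (rfl | hz)
    exacts [hy, hz.1]
  refine le_trans ?_ (Set.ncard_le_ncard h1)
  rw [Set.ncard_insert_of_notMem fun h => by have := h.2; omega]
  exact Nat.succ_le_succ (hP.two_le x h0)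

variable {B : Type v} [CStarAlgebra B] {u : Matrix n n B} (hu : IsMagicUnitary u)
  (hG : CommutesWithAdj G u)
include hu hG

/-- The paths are peeled from their free ends. The ends are the vertices of degree 1, since base
vertices have degree at least 2. The next layer consists of vertices of degree 2 next to a peeled
one; a base vertex next to a peeled vertex carries a path and so has degree at least 3. -/
theorem preserves_end (k : ℕ) : Preserves u (fun x => pos x ≠ 0 ∧ len x ≤ pos x + k) := by
  have hdeg : Preserves u (fun x => {y | G.Adj x y}.ncard) := by
    have := Preserves.ncard_adj hu hG (p := fun _ => True) fun i j h => absurd rfl h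
    simpa using this
  induction k with
  | zero =>
    refine hdeg.of_factor fun i j hij => ?_
    have key : ∀ x, (pos x ≠ 0 ∧ len x ≤ pos x + 0) = ({y | G.Adj x y}.ncard = 1) := fun x => by
      have h1 := hP.pos_le x
      refine propext ⟨fun h => hP.ncard_adj_of_pos_eq_len h.1 (by omega), fun h => ?_⟩
      have h2 : pos x ≠ 0 := fun h0 => by have := hP.two_le_ncard_adj h0; omega
      refine ⟨h2, ?_⟩
      by_contra h3
      have := hP.ncard_adj_of_pos_lt_len h2 (by omega)
      omega
    simp only [key, hij]
  | succ k ih =>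
    refine ((ih.prodMk hdeg).prodMk (ih.ncard_adj hu hG)).of_factor fun i j hij => ?_
    have key : ∀ x, (pos x ≠ 0 ∧ len x ≤ pos x + (k + 1)) =
        ((pos x ≠ 0 ∧ len x ≤ pos x + k) ∨ ({y | G.Adj x y}.ncard = 2 ∧
          {y | G.Adj x y ∧ pos y ≠ 0 ∧ len y ≤ pos y + k}.ncard ≠ 0)) := fun x => by
      have h1 := hP.pos_le x
      refine propext ⟨fun h => ?_, fun h => ?_⟩
      · by_cases h2 : len x ≤ pos x + k
        · exact Or.inl ⟨h.1, h2⟩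
        · refine Or.inr ⟨hP.ncard_adj_of_pos_lt_len h.1 (by omega), ?_⟩
          obtain ⟨y, hy, hyx⟩ := hP.exists_succ x (by omega)
          have h3 := hP.adj hy (by omega)
          refine Set.ncard_ne_zero_of_mem (a := y) ⟨hy, by omega, by omega⟩
      · rcases h with h | ⟨h2, h3⟩
        · exact ⟨h.1, by omega⟩
        · obtain ⟨y, hy, hy0, hyk⟩ := Set.nonempty_of_ncard_ne_zero h3
          have h4 := hP.adj hy hy0
          have h6 := hP.pos_le y
          have h5 : pos x ≠ 0 := fun h5 => by
            have := hP.three_le_ncard_adj h5 (by omega)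
            omega
          exact ⟨h5, by omega⟩
    simp only [Prod.mk.injEq] at hij
    simp only [key]
    simp only [hij]

/-- The set of vertices of the base graph is an invariant. -/
theorem preserves_pos_eq_zero : Preserves u (fun x => pos x = 0) := by
  refine (Preserves.pi (hP.preserves_end hu hG)).of_factor fun i j hij => ?_
  -- The base vertices are those that are never peeled off.
  have key : ∀ x, (pos x = 0) = ¬ ∃ k, pos x ≠ 0 ∧ len x ≤ pos x + k := fun x => by
    refine propext ⟨fun h ⟨k, hk⟩ => hk.1 h, fun h => ?_⟩
    by_contra h0
    exact h ⟨len x, h0, by omega⟩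
  simp only [key]
  exact propext (not_congr (exists_congr fun k => iff_of_eq (congrFun hij k)))

/-- The distances to the ends of the attached paths are invariants. -/
theorem preserves_len_sub_pos (d : ℕ) :
    Preserves u (fun x => pos x ≠ 0 ∧ len x = pos x + d) := by
  cases d with
  | zero =>
    refine (hP.preserves_end hu hG 0).of_factor fun i j hij => ?_
    have h1 := hP.pos_le i
    have h2 := hP.pos_le j
    simp only [eq_iff_iff] at hij ⊢
    omega
  | succ d =>
    refine ((hP.preserves_end hu hG (d + 1)).prodMk (hP.preserves_end hu hG d)).of_factor
      fun i j hij => ?_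
    simp only [Prod.mk.injEq, eq_iff_iff] at hij ⊢
    omega

/-- A base vertex sees the length of its path through its neighbor at position 1, whose distance to
the free end is one less. Length 0 is recognized by the absence of such a neighbor. -/
theorem preserves_len_of_pos_eq_zero (l : ℕ) :
    Preserves u (fun x => pos x = 0 ∧ len x = l) := by
  have hcount (d : ℕ) := (hP.preserves_len_sub_pos hu hG d).ncard_adj hu hG
  refine ((hP.preserves_pos_eq_zero hu hG).prodMk (Preserves.pi hcount)).of_factor
    fun i j hij => ?_
  have key : ∀ x, pos x = 0 → ∀ d,
      ({y | G.Adj x y ∧ pos y ≠ 0 ∧ len y = pos y + d}.ncard ≠ 0 ↔ len x = d + 1) := by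
    intro x hx d
    refine ⟨fun h => ?_, fun h => ?_⟩
    · obtain ⟨y, hy, hy0, hyk⟩ := Set.nonempty_of_ncard_ne_zero h
      have := hP.adj hy hy0
      omega
    · obtain ⟨y, hy, hyx⟩ := hP.exists_succ x (by omega)
      have h3 := hP.adj hy (by omega)
      exact Set.ncard_ne_zero_of_mem (a := y) ⟨hy, by omega, by omega⟩
  simp only [Prod.mk.injEq, eq_iff_iff] at hij ⊢
  have h2 : pos i = 0 → pos j = 0 → ∀ d, (len i = d + 1 ↔ len j = d + 1) := fun hi hj d => by
    rw [← key i hi, ← key j hj, congrFun hij.2 d]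
  have h3 : pos i = 0 → pos j = 0 → len i = len j := fun hi hj => by
    have h4 := h2 hi hj
    rcases hi' : len i with _ | d
    · rcases hj' : len j with _ | d'
      · rfl
      · have := (h4 d').2 hj'; omega
    · have := (h4 d).1 hi'; omega
  constructor
  · rintro ⟨h4, h5⟩
    have h6 := hij.1.1 h4
    exact ⟨h6, by rw [← h3 h4 h6, h5]⟩
  · rintro ⟨h4, h5⟩
    have h6 := hij.1.2 h4
    exact ⟨h6, by rw [h3 h6 h4, h5]⟩

/-- Positions are invariants, and so is every invariant of the base graph, transported along the
paths. -/
theorem preserves_pos_prod {α : Type*} {κ : n → α} (hκ : ∀ {x y}, G.Adj x y → pos y ≠ 0 → κ x = κ y)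
    (hκ0 : ∀ a, Preserves u (fun x => pos x = 0 ∧ κ x = a)) :
    Preserves u (fun x => (pos x, len x, κ x)) := by
  have key : ∀ (k l : ℕ) (a : α), Preserves u (fun x => pos x = k ∧ len x = l ∧ κ x = a) := by
    intro k l a
    induction k with
    | zero =>
      refine ((hP.preserves_len_of_pos_eq_zero hu hG l).prodMk (hκ0 a)).of_factor fun i j hij => ?_
      simp only [Prod.mk.injEq, eq_iff_iff] at hij ⊢
      tauto
    | succ k ih =>
      by_cases hl : k + 1 ≤ l
      · refine ((hP.preserves_len_sub_pos hu hG (l - (k + 1))).prodMk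
          (ih.ncard_adj hu hG)).of_factor fun i j hij => ?_
        -- The distance to the free end fixes only `len x - pos x`; a neighbor already known to sit
        -- at position `k` of a path of length `l` supplies the rest, together with `κ`.
        have key : ∀ x, (pos x = k + 1 ∧ len x = l ∧ κ x = a) =
            ((pos x ≠ 0 ∧ len x = pos x + (l - (k + 1))) ∧
              {y | G.Adj x y ∧ pos y = k ∧ len y = l ∧ κ y = a}.ncard ≠ 0) := fun x => by
          refine propext ⟨fun h => ?_, fun h => ?_⟩
          · obtain ⟨y, hy, hyx⟩ := hP.exists_pred x (by omega)
            have h1 := hP.adj (G.adj_symm hy) (by omega)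
            have h2 := hκ (G.adj_symm hy) (by omega)
            exact ⟨⟨by omega, by omega⟩, Set.ncard_ne_zero_of_mem (a := y)
              ⟨hy, by omega, by omega, h2.trans h.2.2⟩⟩
          · obtain ⟨y, hy, hy0, hyk, hya⟩ := Set.nonempty_of_ncard_ne_zero h.2
            have h1 := hP.adj (G.adj_symm hy) h.1.1
            have h2 := hκ (G.adj_symm hy) h.1.1
            exact ⟨by omega, by omega, h2.symm.trans hya⟩
        simp only [key]
        simp only [Prod.mk.injEq] at hij
        simp only [hij]
      -- For `k + 1 > l` no vertex has the property, so it cannot separate `i` from `j`.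
      · intro i j hij
        refine absurd ?_ hij
        have h1 := hP.pos_le i
        have h2 := hP.pos_le j
        rw [eq_iff_iff]
        omega
  intro i j hij
  refine key (pos i) (len i) (κ i) i j fun h => hij ?_
  have := h.mp ⟨rfl, rfl, rfl⟩
  simp [this]

/-- The entries of `u` are constant along the attached paths. -/
theorem apply_eq_apply_of_adj (hpos : Preserves u pos) {x y x' y' : n} (hxy : G.Adj x y)
    (hxy' : G.Adj x' y') (h : pos x + 1 = pos y) (h' : pos x' + 1 = pos y') (hp : pos x = pos x') :
    u y y' = u x x' := by
  -- In the row sum of `x` only a neighbor of `y'` at the position of `x` survives, and that is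
  -- `x'`. Symmetrically in `h2`, so both entries equal the product `u x x' * u y y'`.
  have h1 : u y y' = u x x' * u y y' := by
    rw [← one_mul (u y y'), ← hu.row_sum x, Finset.sum_mul, Finset.sum_eq_single x']
    · rw [← mul_assoc, hu.mul_self]
    · intro z _ hz
      by_cases hzy : G.Adj z y'
      · by_cases hpz : pos x = pos z
        · exact absurd (hP.unique (G.adj_symm hzy) (G.adj_symm hxy') (by omega) (Or.inl (by omega))) hz
        · rw [hpos x z hpz, zero_mul]
      · rw [← hu.mul_self y y']
        exact hu.mul_eq_zero_of_adj hG hxy hzy |> fun h => by rw [← mul_assoc, h, zero_mul]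
    · simp
  have h2 : u x x' = u x x' * u y y' := by
    conv_lhs => rw [← mul_one (u x x'), ← hu.row_sum y, Finset.mul_sum]
    refine Finset.sum_eq_single y' (fun z _ hz => ?_) (by simp)
    by_cases hzy : G.Adj x' z
    · by_cases hpz : pos y = pos z
      · exact absurd (hP.unique hzy hxy' (by omega) (Or.inr (by omega))) hz
      · rw [hpos y z hpz, mul_zero]
    · exact hu.mul_eq_zero_of_adj hG hxy hzy
  rw [h1, ← h2]

end HasPendantPaths
end magic

/-! ### Vertex colors replaced by pendant paths -/

section vertexDecolor
open scoped Classical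
variable {V : Type u} {S : Type v} {T : Type w}

theorem SimpleGraph.EdgeLabeling.labelGraph_adj_get {G : SimpleGraph V} (e : G.EdgeLabeling T)
    (t : T) (x y : V) : (e.labelGraph t).Adj x y ↔ ∃ h : G.Adj x y, e.get x y h = t :=
  SimpleGraph.EdgeLabeling.labelGraph_adj x y

theorem VertexDecolored.ext {c : V → S} {n : S → ℕ} {x y : VertexDecolored c n}
    (h1 : x.1 = y.1) (h2 : x.2.val = y.2.val) : x = y := by
  obtain ⟨v, a⟩ := x
  obtain ⟨w, b⟩ := y
  obtain rfl : v = w := h1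
  exact congrArg _ (Fin.ext h2)

/-- The vertex `v` of `G`, as a vertex of the vertex-decolored graph. -/
def VertexDecolored.base (c : V → S) (n : S → ℕ) (v : V) : VertexDecolored c n := ⟨v, 0⟩

theorem VertexDecolored.base_injective (c : V → S) (n : S → ℕ) :
    Function.Injective (VertexDecolored.base c n) := fun _ _ h => congrArg Sigma.fst h

theorem VertexDecolored.mem_range_base {c : V → S} {n : S → ℕ} {x : VertexDecolored c n} :
    x ∈ Set.range (VertexDecolored.base c n) ↔ x.2.val = 0 :=
  ⟨by rintro ⟨v, rfl⟩; rfl, fun h => ⟨x.1, VertexDecolored.ext rfl h.symm⟩⟩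

/-- A path edge stays over a single vertex of `G`. As `G` has no loops, the case distinction in the
labeling therefore sends it to `c₀`. -/
theorem labelGraph_vertexDecolorLabel_adj (G : SimpleGraph V) (c : V → S) (n : S → ℕ)
    (e : G.EdgeLabeling T) (c₀ t : T) (x y : VertexDecolored c n) :
    ((vertexDecolorLabel G c n e c₀).labelGraph t).Adj x y ↔
      (x.2.val = 0 ∧ y.2.val = 0 ∧ (e.labelGraph t).Adj x.1 y.1) ∨
      (x.1 = y.1 ∧ (x.2.val + 1 = y.2.val ∨ y.2.val + 1 = x.2.val) ∧ t = c₀) := by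
  rw [SimpleGraph.EdgeLabeling.labelGraph_adj_get, SimpleGraph.EdgeLabeling.labelGraph_adj_get]
  have hget : ∀ h, (vertexDecolorLabel G c n e c₀).get x y h =
      if h : G.Adj x.1 y.1 then e.get x.1 y.1 h else c₀ := fun h => rfl
  constructor
  · rintro ⟨h, ht⟩
    rw [hget] at ht
    rcases h with ⟨h1, h2, h3⟩ | ⟨h1, h2⟩
    · rw [dif_pos h3] at ht
      exact Or.inl ⟨h1, h2, h3, ht⟩
    · rw [dif_neg fun h' => h'.ne h1] at ht
      exact Or.inr ⟨h1, h2, ht.symm⟩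
  · rintro (⟨h1, h2, h3, ht⟩ | ⟨h1, h2, ht⟩)
    · exact ⟨Or.inl ⟨h1, h2, h3⟩, (hget _).trans ((dif_pos h3).trans ht)⟩
    · exact ⟨Or.inr ⟨h1, h2⟩, (hget _).trans ((dif_neg fun h' => h'.ne h1).trans ht.symm)⟩

variable [Fintype V] (G : SimpleGraph V) (c : V → S) (n : S → ℕ)

theorem hasPendantPaths_vertexDecolor (hdeg : ∀ v, 2 ≤ {w | G.Adj v w}.ncard) :
    HasPendantPaths (vertexDecolor G c n) (fun x => x.2.val) (fun x => n (c x.1)) where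
  pos_le x := Nat.lt_succ_iff.1 x.2.2
  adj := by
    rintro x y (⟨h1, h2, h3⟩ | ⟨h1, h2⟩) h
    · exact absurd h2 h
    · exact ⟨h2, by rw [h1]⟩
  exists_pred x h :=
    ⟨⟨x.1, ⟨x.2.val - 1, by omega⟩⟩, Or.inr ⟨rfl, Or.inr (Nat.succ_pred_eq_of_ne_zero h)⟩,
      Nat.succ_pred_eq_of_ne_zero h⟩
  exists_succ x h := ⟨⟨x.1, ⟨x.2.val + 1, by omega⟩⟩, Or.inr ⟨rfl, Or.inl rfl⟩, rfl⟩
  unique := by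
    rintro x y z (⟨h1, h2, h3⟩ | ⟨h1, h2⟩) (⟨h4, h5, h6⟩ | ⟨h4, h5⟩) h h'
    · omega
    · omega
    · omega
    · exact VertexDecolored.ext (h1.symm.trans h4) h
  two_le x hx := by
    refine (hdeg x.1).trans ?_
    rw [← Set.ncard_image_of_injective _ (VertexDecolored.base_injective c n)]
    refine Set.ncard_le_ncard ?_
    rintro _ ⟨w, hw, rfl⟩
    exact ⟨Or.inl ⟨hx, rfl, hw⟩, rfl⟩

variable {c n} {G} {e : G.EdgeLabeling T} {c₀ : T} {B : Type w'} [CStarAlgebra B]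

section restrict
variable {u : Matrix (VertexDecolored c n) (VertexDecolored c n) B}
  (hu : IsQutMatrix (vertexDecolor G c n) (fun _ => ()) (vertexDecolorLabel G c n e c₀) u)
  (hdeg : ∀ v, 2 ≤ {w | G.Adj v w}.ncard)
include hu hdeg

theorem IsQutMatrix.preserves_vertexDecolored :
    Preserves u (fun x => (x.2.val, n (c x.1))) := by
  have hP := hasPendantPaths_vertexDecolor G c n hdeg
  have hA := commutesWithAdj_of_labelGraph hu.toIsMagicUnitary hu.edgeColor
  refine (hP.preserves_pos_prod hu.toIsMagicUnitary hA (κ := fun _ => ()) (fun _ _ => rfl)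
    fun _ => (hP.preserves_pos_eq_zero hu.toIsMagicUnitary hA).of_factor
      fun i j h => ?_).of_factor fun i j h => ?_
  · simpa using h
  · simpa using h

theorem IsQutMatrix.preserves_base :
    Preserves u (· ∈ Set.range (VertexDecolored.base c n)) :=
  (hu.preserves_vertexDecolored hdeg).of_factor fun i j h => by
    rw [VertexDecolored.mem_range_base, VertexDecolored.mem_range_base, show i.2.val = j.2.val from (Prod.ext_iff.1 h).1]

/-- The vertex colors of `G` survive only as path lengths; injectivity of `n` on the colors that
occur recovers them. -/
theorem IsQutMatrix.submatrix_base (hn : Set.InjOn n (Set.range c)) :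
    IsQutMatrix G c e (u.submatrix (VertexDecolored.base c n) (VertexDecolored.base c n)) where
  toIsMagicUnitary := hu.toIsMagicUnitary.submatrix (VertexDecolored.base_injective c n)
    (hu.preserves_base hdeg)
  vertexColor i j hij := hu.preserves_vertexDecolored hdeg _ _ fun h =>
    hij (hn (Set.mem_range_self i) (Set.mem_range_self j) (Prod.ext_iff.1 h).2)
  edgeColor t := by
    have := (hu.edgeColor t).submatrix (VertexDecolored.base_injective c n)
      (hu.preserves_base hdeg)
    convert this using 1
    ext i j
    rw [SimpleGraph.comap_adj, labelGraph_vertexDecolorLabel_adj]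
    simp [VertexDecolored.base]

/-- Descending both paths in parallel does not change the entry, so the base block contains every
nonzero entry of `u`. -/
theorem IsQutMatrix.apply_eq_apply_base (x y : VertexDecolored c n) (hxy : x.2.val = y.2.val) :
    u x y = u (VertexDecolored.base c n x.1) (VertexDecolored.base c n y.1) := by
  have hP := hasPendantPaths_vertexDecolor G c n hdeg
  have hA := commutesWithAdj_of_labelGraph hu.toIsMagicUnitary hu.edgeColor
  obtain ⟨v, a, ha⟩ := x
  obtain ⟨w, b, hb⟩ := y
  obtain rfl : a = b := hxy
  induction a with
  | zero => rfl
  | succ a ih =>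
    rw [← ih (by omega) (by omega)]
    exact hP.apply_eq_apply_of_adj hu.toIsMagicUnitary hA
      ((hu.preserves_vertexDecolored hdeg).of_factor fun i j h => (Prod.ext_iff.1 h).1)
      (x := ⟨v, a, by omega⟩) (x' := ⟨w, a, by omega⟩) (Or.inr ⟨rfl, Or.inl rfl⟩)
      (Or.inr ⟨rfl, Or.inl rfl⟩) rfl rfl rfl

end restrict

section extend

/-- The extension of a matrix indexed by the vertices of `G` to the vertex-decolored graph. -/
def vertexExtend (c : V → S) (n : S → ℕ) {B : Type*} [Zero B] (x : Matrix V V B) :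
    Matrix (VertexDecolored c n) (VertexDecolored c n) B :=
  fun p q => if p.2.val = q.2.val then x p.1 q.1 else 0

theorem IsMagicUnitary.vertexExtend_row_sum {x : Matrix V V B} (hx : IsMagicUnitary x)
    (hc : Preserves x c) (p : VertexDecolored c n) : ∑ q, vertexExtend c n x p q = 1 := by
  rw [← hx.row_sum p.1, Fintype.sum_sigma]
  refine Finset.sum_congr rfl fun w _ => ?_
  by_cases h : c p.1 = c w
  -- Equal colors mean equal path lengths, so the path at `w` has a vertex at the position of `p`;
  -- for different colors the entry of `x` is already zero.
  · rw [Finset.sum_eq_single ⟨p.2.val, by rw [← h]; exact p.2.2⟩]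
    · exact if_pos rfl
    · intro b _ hb
      exact if_neg fun h' => hb (Fin.ext h'.symm)
    · simp
  · rw [hc _ _ h]
    refine Finset.sum_eq_zero fun b _ => ?_
    rw [vertexExtend, hc _ _ h, ite_self]

omit [Fintype V] in
theorem vertexExtend_transpose (x : Matrix V V B) :
    (vertexExtend c n x).transpose = vertexExtend c n x.transpose := by
  ext p q
  simp [vertexExtend, eq_comm]

variable {x : Matrix V V B}

/-- Repeating `x` at every height respects the base edges by the relations of `x`, and the path
edges by orthogonality within a row or column of `x`. -/
theorem IsQutMatrix.vertexExtend (hx : IsQutMatrix G c e x) :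
    IsQutMatrix (vertexDecolor G c n) (fun _ => ()) (vertexDecolorLabel G c n e c₀)
      (vertexExtend c n x) := by
  have hm : IsMagicUnitary (_root_.vertexExtend c n x) :=
    { star_eq := fun p q => by
        unfold _root_.vertexExtend
        split_ifs
        exacts [hx.star_eq _ _, star_zero B]
      mul_self := fun p q => by
        unfold _root_.vertexExtend
        split_ifs
        exacts [hx.mul_self _ _, mul_zero 0]
      row_sum := hx.toIsMagicUnitary.vertexExtend_row_sum hx.vertexColor
      col_sum := fun p => by
        have := hx.toIsMagicUnitary.transpose.vertexExtend_row_sum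
          (Preserves.transpose hx.vertexColor) p
        rwa [← vertexExtend_transpose] at this }
  -- The second product is the first with rows and columns exchanged; the two supply both hypotheses
  -- of `IsMagicUnitary.commutesWithAdj`.
  have key : ∀ t, ∀ i j a b : VertexDecolored c n,
      ((vertexDecolorLabel G c n e c₀).labelGraph t).Adj i j →
      ¬((vertexDecolorLabel G c n e c₀).labelGraph t).Adj a b →
      (_root_.vertexExtend c n x i a * _root_.vertexExtend c n x j b = 0 ∧
       _root_.vertexExtend c n x a i * _root_.vertexExtend c n x b j = 0) := by
    intro t i j a b hij hab
    rw [labelGraph_vertexDecolorLabel_adj] at hij hab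
    unfold _root_.vertexExtend
    by_cases h1 : i.2.val = a.2.val
    swap
    · rw [if_neg h1, if_neg (Ne.symm h1), zero_mul, zero_mul]; exact ⟨rfl, rfl⟩
    by_cases h2 : j.2.val = b.2.val
    swap
    · rw [if_neg h2, if_neg (Ne.symm h2), mul_zero, mul_zero]; exact ⟨rfl, rfl⟩
    rw [if_pos h1, if_pos h2, if_pos h1.symm, if_pos h2.symm]
    rcases hij with ⟨h3, h4, h5⟩ | ⟨h3, h4, h5⟩
    · have h6 : ¬ (e.labelGraph t).Adj a.1 b.1 := fun h6 =>
        hab (Or.inl ⟨by omega, by omega, h6⟩)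
      exact ⟨hx.mul_eq_zero_of_adj (hx.edgeColor t) h5 h6,
        hx.mul_eq_zero_of_adj' (hx.edgeColor t) h6 h5⟩
    -- The heights of `a` and `b` agree with those of the path edge, so being over the same vertex
    -- would make `a` and `b` adjacent.
    · have h6 : a.1 ≠ b.1 := fun h6 => hab (Or.inr ⟨h6, by omega, h5⟩)
      rw [h3]
      exact ⟨hx.row_orthogonal _ h6, hx.col_orthogonal _ h6⟩
  exact
    { toIsMagicUnitary := hm
      vertexColor := fun _ _ h => absurd rfl h
      edgeColor := fun t => hm.commutesWithAdj (fun i j a b hij hab => (key t i j a b hij hab).1)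
        fun i j a b hij hab => (key t a b i j hab hij).2 }

end extend

/-- Attaching paths instead of coloring the vertices does not change the quantum automorphism
group. -/
theorem qut_isomorphic_qut_vertexDecolor (G : SimpleGraph V) (c : V → S) (e : G.EdgeLabeling T)
    (n : S → ℕ) (hn : Set.InjOn n (Set.range c)) (c₀ : T)
    (hdeg : ∀ v, 2 ≤ {w | G.Adj v w}.ncard) :
    (qut G c e).Isomorphic
      (qut (vertexDecolor G c n) (fun _ => ()) (vertexDecolorLabel G c n e c₀)) := by
  have hU := isQutMatrix_genMatrix (vertexDecolor G c n) (fun _ => ())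
    (vertexDecolorLabel G c n e c₀)
  have hX := isQutMatrix_genMatrix G c e
  let Φ := (qutRelations G c e).lift (v := fun p => (qutRelations _ _ _).genMatrix
    (VertexDecolored.base c n p.1) (VertexDecolored.base c n p.2)) (hU.submatrix_base hdeg hn)
  let Ψ := (qutRelations (vertexDecolor G c n) (fun _ => ())
    (vertexDecolorLabel G c n e c₀)).lift
    (v := fun p => vertexExtend c n (qutRelations G c e).genMatrix p.1 p.2) hX.vertexExtend
  have hΦ : ∀ i j, Φ ((qutRelations G c e).genMatrix i j) = (qutRelations _ _ _).genMatrix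
      (VertexDecolored.base c n i) (VertexDecolored.base c n j) :=
    fun i j => CStarRelations.lift_gen _ _ (i, j)
  have hΨ : ∀ i j, Ψ ((qutRelations _ _ _).genMatrix i j) =
      vertexExtend c n (qutRelations G c e).genMatrix i j :=
    fun i j => CStarRelations.lift_gen _ _ (i, j)
  refine CompactMatrixQuantumGroup.isomorphic_of_block (𝔾 := qut G c e) Φ Ψ
    (VertexDecolored.base c n) (VertexDecolored.base_injective c n) hΦ ?_ ?_ ?_
  · intro i j
    exact (hΨ _ _).trans (if_pos rfl)
  · intro a b
    refine (congrArg Φ (hΨ a b)).trans ?_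
    unfold vertexExtend
    by_cases h : a.2.val = b.2.val
    · rw [if_pos h, hΦ]
      exact (hU.apply_eq_apply_base hdeg a b h).symm
    · rw [if_neg h, map_zero]
      exact (hU.preserves_vertexDecolored hdeg a b fun h' => h (Prod.ext_iff.1 h').1).symm
  · intro i z hz
    exact hU.preserves_base hdeg _ _ (by simpa using hz)

end vertexDecolor

/-! ### Edge colors replaced by subdivisions with pendant paths -/

section edgeDecolor
open scoped Classical
variable {W : Type u} {T : Type w} {H : SimpleGraph W} {e : H.EdgeLabeling T} {c₀ : T} {m : T → ℕ}

theorem edgeDecolor_adj_inr_inl {x : W}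
    {f : Σ f : {f : H.edgeSet // e f ≠ c₀}, Fin (m (e f.1) + 1)} :
    (edgeDecolor H e c₀ m).Adj (.inr f) (.inl x) ↔ x ∈ (f.1.1 : Sym2 W) ∧ f.2.val = 0 := Iff.rfl

theorem edgeDecolor_adj_inr_inr {f g : Σ f : {f : H.edgeSet // e f ≠ c₀}, Fin (m (e f.1) + 1)} :
    (edgeDecolor H e c₀ m).Adj (.inr f) (.inr g) ↔
      f.1 = g.1 ∧ (f.2.val + 1 = g.2.val ∨ g.2.val + 1 = f.2.val) := Iff.rfl

theorem EdgeDecolored.inr_ext {f g : Σ f : {f : H.edgeSet // e f ≠ c₀}, Fin (m (e f.1) + 1)}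
    (h1 : f.1 = g.1) (h2 : f.2.val = g.2.val) : f = g := by
  obtain ⟨v, a⟩ := f
  obtain ⟨w, b⟩ := g
  obtain rfl : v = w := h1
  exact congrArg _ (Fin.ext h2)

/-- The position of a vertex of the edge-decolored graph on the path to which it belongs. -/
def EdgeDecolored.pos (pos : W → ℕ) : EdgeDecolored H e c₀ m → ℕ :=
  Sum.elim pos fun f => f.2.val

/-- The length of the path to which a vertex of the edge-decolored graph belongs. -/
def EdgeDecolored.len (len : W → ℕ) : EdgeDecolored H e c₀ m → ℕ :=
  Sum.elim len fun f => m (e f.1.1)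

/-- `none` for the original vertices and the color of the edge for the vertices arising from it. -/
def EdgeDecolored.kind : EdgeDecolored H e c₀ m → Option T :=
  Sum.elim (fun _ => none) fun f => some (e f.1.1)

/-- The vertex that subdivides the edge `f`. -/
def EdgeDecolored.mid (m : T → ℕ) (f : {f : H.edgeSet // e f ≠ c₀}) : EdgeDecolored H e c₀ m :=
  .inr ⟨f, 0⟩

variable [Fintype W]

section paths
variable {pos len : W → ℕ} (hH : HasPendantPaths H pos len)
  (hpos : ∀ f : {f : H.edgeSet // e f ≠ c₀}, ∀ x ∈ (f.1 : Sym2 W), pos x = 0)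
-- A base neighbor `w` of `x` is sent to itself if the edge has color `c₀`, and otherwise to the
-- vertex subdividing {x, w}. The map is injective because an edge at `x` determines its other end.
theorem ncard_adj_le_ncard_edgeDecolor_adj (x : W) :
    {w | H.Adj x w ∧ pos w = 0}.ncard ≤ {y | (edgeDecolor H e c₀ m).Adj (.inl x) y ∧
      EdgeDecolored.pos pos y = 0}.ncard := by
  have h : ∀ w, H.Adj x w ∧ pos w = 0 → ∃ y : EdgeDecolored H e c₀ m,
      ((edgeDecolor H e c₀ m).Adj (.inl x) y ∧ EdgeDecolored.pos pos y = 0) ∧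
      (y = .inl w ∨ ∃ f, y = .inr f ∧ (f.1.1 : Sym2 W) = s(x, w)) := by
    rintro w ⟨h1, h2⟩
    by_cases h3 : e.get x w h1 = c₀
    · exact ⟨.inl w, ⟨⟨h1, h3⟩, h2⟩, Or.inl rfl⟩
    · exact ⟨.inr ⟨⟨⟨s(x, w), h1⟩, h3⟩, 0⟩, ⟨⟨Sym2.mem_mk_left x w, rfl⟩, rfl⟩,
        Or.inr ⟨_, rfl, rfl⟩⟩
  choose! F hF hF' using h
  refine Set.ncard_le_ncard_of_injOn F hF fun w hw w' hw' hww' => ?_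
  have h1 := hF' w hw
  have h2 := hF' w' hw'
  rw [← hww'] at h2
  rcases h1 with h1 | ⟨f, h1, h3⟩ <;> rcases h2 with h2 | ⟨g, h2, h4⟩
  · exact Sum.inl_injective (h1.symm.trans h2)
  · exact absurd (h1.symm.trans h2) (by simp)
  · exact absurd (h1.symm.trans h2) (by simp)
  · obtain rfl := Sum.inr_injective (h1.symm.trans h2)
    exact Sym2.congr_right.1 (h3.symm.trans h4)

include hpos

omit [Fintype W] in
-- The two ends of the edge have position 0 by `hpos`, while a neighbor on the attached path has
-- position 1. This count tells subdividing vertices from original ones.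
theorem ncard_edgeDecolor_adj_inr
    {f : Σ f : {f : H.edgeSet // e f ≠ c₀}, Fin (m (e f.1) + 1)} (hf : f.2.val = 0) :
    {y | (edgeDecolor H e c₀ m).Adj (.inr f) y ∧ EdgeDecolored.pos pos y = 0}.ncard = 2 := by
  obtain ⟨⟨⟨s, hs⟩, hc⟩, a⟩ := f
  induction s using Sym2.inductionOn with
  | hf i j =>
  rw [Set.ncard_eq_two]
  refine ⟨.inl i, .inl j, fun h => hs.ne (Sum.inl_injective h), Set.ext fun y => ?_⟩
  constructor
  · rintro ⟨h1, h2⟩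
    rcases y with y | g
    · rcases Sym2.mem_iff.1 (edgeDecolor_adj_inr_inl.1 h1).1 with rfl | rfl
      exacts [Or.inl rfl, Or.inr rfl]
    · have h3 := (edgeDecolor_adj_inr_inr.1 h1).2
      change g.2.val = 0 at h2
      omega
  · rintro (rfl | rfl)
    · exact ⟨⟨Sym2.mem_mk_left _ _, hf⟩, hpos ⟨⟨s(i, j), hs⟩, hc⟩ _ (Sym2.mem_mk_left _ _)⟩
    · exact ⟨⟨Sym2.mem_mk_right _ _, hf⟩, hpos ⟨⟨s(i, j), hs⟩, hc⟩ _ (Sym2.mem_mk_right _ _)⟩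

omit [Fintype W] in
-- Guarantees that the edges of the old pendant paths are not subdivided.
theorem get_eq_of_pos_ne_zero {x y : W} (h : H.Adj x y) (hx : pos x ≠ 0 ∨ pos y ≠ 0) :
    e.get x y h = c₀ := by
  by_contra hc
  rcases hx with hx | hx
  · exact hx (hpos ⟨⟨s(x, y), h⟩, hc⟩ x (Sym2.mem_mk_left _ _))
  · exact hx (hpos ⟨⟨s(x, y), h⟩, hc⟩ y (Sym2.mem_mk_right _ _))

include hH

/-- The peeling argument is thus available a second time. The new base consists of the old base and
the subdividing vertices, which have position 0 on their own paths. -/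
theorem HasPendantPaths.edgeDecolor :
    HasPendantPaths (edgeDecolor H e c₀ m) (EdgeDecolored.pos pos) (EdgeDecolored.len len) where
  pos_le := by
    rintro (x | f)
    · exact hH.pos_le x
    · exact Nat.lt_succ_iff.1 f.2.2
  adj := by
    rintro (x | f) (y | g) h hy
    · exact hH.adj h.1 hy
    · exact absurd h.2 hy
    · exact absurd (hpos _ _ h.1) hy
    · exact ⟨h.2, congrArg (fun f : {f : H.edgeSet // e f ≠ c₀} => m (e f.1)) h.1⟩
  exists_pred := by
    rintro (x | f) hx
    · obtain ⟨y, hy, hyx⟩ := hH.exists_pred x hx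
      exact ⟨.inl y, ⟨hy, get_eq_of_pos_ne_zero hpos hy (Or.inl hx)⟩, hyx⟩
    · exact ⟨.inr ⟨f.1, ⟨f.2.val - 1, by omega⟩⟩,
        ⟨rfl, Or.inr (Nat.succ_pred_eq_of_ne_zero hx)⟩, Nat.succ_pred_eq_of_ne_zero hx⟩
  exists_succ := by
    rintro (x | f) hx
    · obtain ⟨y, hy, hyx⟩ := hH.exists_succ x hx
      exact ⟨.inl y, ⟨hy, get_eq_of_pos_ne_zero hpos hy (Or.inr (by omega))⟩, hyx⟩
    · exact ⟨.inr ⟨f.1, ⟨f.2.val + 1, Nat.succ_lt_succ hx⟩⟩, ⟨rfl, Or.inl rfl⟩, rfl⟩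
  unique := by
    rintro (x | f) (y | g) (z | k) hy hz h h'
    · exact congrArg _ (hH.unique hy.1 hz.1 h h')
    · have h1 : pos x = 0 := hpos _ _ hz.1
      have h2 : k.2.val = 0 := hz.2
      have h3 : pos y = k.2.val := h
      rcases h' with h' | h'
      exacts [absurd h1 h', absurd (h3.trans h2) h']
    · have h1 : pos x = 0 := hpos _ _ hy.1
      rcases h' with h' | h'
      exacts [absurd h1 h', absurd hy.2 h']
    · rcases h' with h' | h'
      exacts [absurd (hpos _ _ hy.1) h', absurd hy.2 h']
    · rcases h' with h' | h'
      exacts [absurd hy.2 h', absurd (hpos _ _ hy.1) h']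
    · rcases h' with h' | h'
      exacts [absurd hy.2 h', absurd (hpos _ _ hy.1) h']
    · rcases h' with h' | h'
      exacts [absurd hz.2 h', absurd (h.trans (hpos _ _ hz.1)) h']
    · exact congrArg _ (EdgeDecolored.inr_ext (hy.1.symm.trans hz.1) h)
  two_le := by
    rintro (x | f) hx
    · exact (hH.two_le x hx).trans (ncard_adj_le_ncard_edgeDecolor_adj x)
    · exact (ncard_edgeDecolor_adj_inr hpos hx).ge

/-- Among base vertices, the number of base neighbors separates subdividing vertices from original
ones; for the former, the path length then gives the edge color by `hm`. Since `kind` is constant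
along paths, it propagates to all vertices. -/
theorem preserves_pos_kind (hm : Set.InjOn m (Set.range e \ {c₀}))
    (hdeg : ∀ x, pos x = 0 → 3 ≤ {w | H.Adj x w ∧ pos w = 0}.ncard)
    {B : Type w'} [CStarAlgebra B] {u : Matrix (EdgeDecolored H e c₀ m) (EdgeDecolored H e c₀ m) B}
    (hu : IsMagicUnitary u) (hA : CommutesWithAdj (edgeDecolor H e c₀ m) u) :
    Preserves u (fun x => (EdgeDecolored.pos pos x, EdgeDecolored.kind x)) := by
  have hP := hH.edgeDecolor (m := m) hpos
  have h0 := hP.preserves_pos_eq_zero hu hA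
  -- Two base neighbors for a subdividing vertex, at least three for an original base vertex.
  have hinr : Preserves u (fun x => EdgeDecolored.pos pos x = 0 ∧ x.isRight) := by
    refine (h0.prodMk (h0.ncard_adj hu hA)).of_factor fun i j hij => ?_
    have key : ∀ x : EdgeDecolored H e c₀ m, (EdgeDecolored.pos pos x = 0 ∧ x.isRight) =
        (EdgeDecolored.pos pos x = 0 ∧ {y | (edgeDecolor H e c₀ m).Adj x y ∧
          EdgeDecolored.pos pos y = 0}.ncard = 2) := fun x => by
      refine propext (and_congr_right fun hx => ?_)
      rcases x with x | f
      · have h1 := (hdeg x hx).trans (ncard_adj_le_ncard_edgeDecolor_adj (e := e) (c₀ := c₀) (m := m) x)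
        refine ⟨fun h => by simp at h, fun h => ?_⟩
        omega
      · exact ⟨fun _ => ncard_edgeDecolor_adj_inr hpos hx, fun _ => rfl⟩
    simp only [Prod.mk.injEq] at hij
    simp only [key]
    simp only [hij]
  refine (hP.preserves_pos_prod hu hA (κ := EdgeDecolored.kind) ?_ ?_).of_factor fun i j h => ?_
  · rintro (x | f) (y | g) h hy
    · rfl
    · exact absurd h.2 hy
    · exact absurd (hpos _ _ h.1) hy
    · exact congrArg (fun f : {f : H.edgeSet // e f ≠ c₀} => some (e f.1)) h.1
  · intro a
    refine ((h0.prodMk hinr).prodMk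
      (Preserves.pi (hP.preserves_len_of_pos_eq_zero hu hA))).of_factor fun i j hij => ?_
    obtain ⟨⟨h1, h2⟩, h3⟩ : ((_ = _) ∧ _ = _) ∧ _ = _ := by
      simpa only [Prod.mk.injEq] using hij
    have h4 (l : ℕ) := congrFun h3 l
    simp only [eq_iff_iff] at h1 h2 h4 ⊢
    have key : ∀ x y : EdgeDecolored H e c₀ m, (EdgeDecolored.pos pos x = 0 ∧ x.isRight ↔
        EdgeDecolored.pos pos y = 0 ∧ y.isRight) →
        (∀ l, EdgeDecolored.pos pos x = 0 ∧ EdgeDecolored.len len x = l ↔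
          EdgeDecolored.pos pos y = 0 ∧ EdgeDecolored.len len y = l) →
        EdgeDecolored.pos pos x = 0 ∧ EdgeDecolored.kind x = a →
        EdgeDecolored.pos pos y = 0 ∧ EdgeDecolored.kind y = a := by
      rintro x y h2 h3 ⟨h5, h6⟩
      obtain ⟨h7, h8⟩ := (h3 _).1 ⟨h5, rfl⟩
      refine ⟨h7, ?_⟩
      rw [← h6]
      rcases x with x | f <;> rcases y with y | g
      · rfl
      · exact absurd (h2.2 ⟨h7, rfl⟩).2 (by simp)
      · exact absurd (h2.1 ⟨h5, rfl⟩).2 (by simp)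
      · exact congrArg some (hm ⟨⟨_, rfl⟩, g.1.2⟩ ⟨⟨_, rfl⟩, f.1.2⟩ h8)
    exact ⟨key i j h2 h4, key j i h2.symm fun l => (h4 l).symm⟩
  · simp only [Prod.mk.injEq] at h ⊢
    exact ⟨h.1, h.2.2⟩

end paths

/-! ### From the edge-decolored graph to the edge-colored graph -/

theorem EdgeDecolored.sum_eq {B : Type*} [AddCommMonoid B] (F : EdgeDecolored H e c₀ m → B) :
    ∑ z, F z = ∑ w, F (.inl w) + ∑ f : {f : H.edgeSet // e f ≠ c₀},
      ∑ a : Fin (m (e f.1) + 1), F (.inr ⟨f, a⟩) := by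
  refine (Fintype.sum_sum_type F).trans (congrArg _ ?_)
  convert Fintype.sum_sigma _

theorem Sym2.sum_ite_mem {B : Type*} [AddCommMonoid B] {k l : W} (h : k ≠ l) (F : W → B) :
    ∑ w, (if w ∈ s(k, l) then F w else 0) = F k + F l := by
  rw [← Finset.sum_filter, ← Finset.sum_pair h]
  congr 1
  ext; simp

section restrict
variable {B : Type w'} [CStarAlgebra B]
  {u : Matrix (EdgeDecolored H e c₀ m) (EdgeDecolored H e c₀ m) B}
  (hu : IsMagicUnitary u) (hA : CommutesWithAdj (edgeDecolor H e c₀ m) u)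
  (hk : Preserves u EdgeDecolored.kind)
include hk

omit [Fintype W] in
theorem preserves_range_inl : Preserves u (· ∈ Set.range (Sum.inl : W → EdgeDecolored H e c₀ m)) :=
  hk.of_factor fun i j h => by
    rcases i with i | f <;> rcases j with j | g <;> simp [EdgeDecolored.kind] at h ⊢

include hu hA

omit hu in
-- This is the entry at `i` and the vertex subdividing `f` of `u A = A u`. Among the neighbors of
-- that vertex only the ends `k` and `l` contribute, the entry at a path vertex being zero by `hk`.
theorem inl_add_inl_eq_sum (i : W) {f : {f : H.edgeSet // e f ≠ c₀}} {k l : W}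
    (hf : (f.1 : Sym2 W) = s(k, l)) :
    u (.inl i) (.inl k) + u (.inl i) (.inl l) =
      ∑ z, if (edgeDecolor H e c₀ m).Adj (.inl i) z then u z (EdgeDecolored.mid m f) else 0 := by
  have hkl : k ≠ l := by
    have h := f.1.2
    rw [hf] at h
    exact SimpleGraph.Adj.ne h
  rw [(commutesWithAdj_iff _ u).1 hA, EdgeDecolored.sum_eq,
    ← Sym2.sum_ite_mem hkl fun w => u (.inl i) (.inl w)]
  refine (add_zero _).symm.trans (congrArg₂ (· + ·) ?_ ?_)
  · refine Finset.sum_congr rfl fun w _ => ?_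
    rw [← hf]
    refine if_congr ?_ rfl rfl
    exact ⟨fun h => ⟨h, rfl⟩, fun h => h.1⟩
  · refine (Finset.sum_eq_zero fun g _ => Finset.sum_eq_zero fun a _ => ?_).symm
    rw [hk _ _ (by simp [EdgeDecolored.kind]), ite_self]

/-- The entries indexed by the subdividing vertices are determined by those indexed by the original
vertices. -/
theorem apply_mid_mid {f g : {f : H.edgeSet // e f ≠ c₀}} {i j k l : W}
    (hf : (f.1 : Sym2 W) = s(i, j)) (hg : (g.1 : Sym2 W) = s(k, l)) :
    u (EdgeDecolored.mid m f) (EdgeDecolored.mid m g) =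
      u (.inl i) (.inl k) * u (.inl j) (.inl l) + u (.inl i) (.inl l) * u (.inl j) (.inl k) := by
  have hij : i ≠ j := by
    have h := f.1.2
    rw [hf] at h
    exact SimpleGraph.Adj.ne h
  have hij' : (Sum.inl i : EdgeDecolored H e c₀ m) ≠ .inl j := fun h => hij (Sum.inl_injective h)
  have h1 : u (.inl i) (.inl k) * u (.inl j) (.inl l) + u (.inl i) (.inl l) * u (.inl j) (.inl k) =
      (u (.inl i) (.inl k) + u (.inl i) (.inl l)) * (u (.inl j) (.inl k) + u (.inl j) (.inl l)) := by
    rw [add_mul, mul_add, mul_add, hu.col_orthogonal _ hij', hu.col_orthogonal _ hij']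
    abel
  -- The factors become sums over the neighbors of `i` and of `j`, all taken in the column of the
  -- vertex subdividing `g`. Column orthogonality leaves the common neighbors; original vertices
  -- drop out by kind, and the only common subdividing vertex is that of `f`.
  rw [h1, inl_add_inl_eq_sum hA hk i hg, inl_add_inl_eq_sum hA hk j hg, Finset.sum_mul_sum]
  rw [Finset.sum_eq_single (EdgeDecolored.mid m f), Finset.sum_eq_single (EdgeDecolored.mid m f)]
  · rw [if_pos ⟨by rw [hf]; exact Sym2.mem_mk_left _ _, rfl⟩,
      if_pos ⟨by rw [hf]; exact Sym2.mem_mk_right _ _, rfl⟩, hu.mul_self]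
  · intro z _ hz
    split_ifs <;> simp [hu.col_orthogonal _ hz.symm]
  · simp
  · intro z _ hz
    refine Finset.sum_eq_zero fun z' _ => ?_
    by_cases hzz : z = z'
    · subst hzz
      rcases z with z | f'
      · rw [hk (.inl z) _ (by simp [EdgeDecolored.kind, EdgeDecolored.mid]), ite_self, zero_mul]
      · by_cases h2 : (edgeDecolor H e c₀ m).Adj (.inl i) (.inr f')
        · by_cases h3 : (edgeDecolor H e c₀ m).Adj (.inl j) (.inr f')
          · refine absurd (congrArg Sum.inr (EdgeDecolored.inr_ext ?_ h2.2)) hz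
            refine Subtype.ext (Subtype.ext ?_)
            rw [hf]
            exact ((Sym2.mem_and_mem_iff hij).1 ⟨h2.1, h3.1⟩)
          · rw [if_neg h3, mul_zero]
        · rw [if_neg h2, zero_mul]
    · split_ifs <;> simp [hu.col_orthogonal _ hzz]
  · simp

/-- Naming the ends of both edges in the other order gives `u_jl u_ik + u_jk u_il = u_ik u_jl + u_il
u_jk`. Left multiplication by `u_ik` kills the second term on each side, so `u_ik u_jl = u_ik u_jl
u_ik` is self-adjoint. -/
theorem commute_of_edges {f g : {f : H.edgeSet // e f ≠ c₀}} {i j k l : W}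
    (hf : (f.1 : Sym2 W) = s(i, j)) (hg : (g.1 : Sym2 W) = s(k, l)) :
    u (.inl i) (.inl k) * u (.inl j) (.inl l) = u (.inl j) (.inl l) * u (.inl i) (.inl k) := by
  have h1 := apply_mid_mid hu hA hk hf hg
  rw [apply_mid_mid hu hA hk (hf.trans Sym2.eq_swap) (hg.trans Sym2.eq_swap)] at h1
  have hij : i ≠ j := by
    have h := f.1.2
    rw [hf] at h
    exact SimpleGraph.Adj.ne h
  have hkl : k ≠ l := by
    have h := g.1.2
    rw [hg] at h
    exact SimpleGraph.Adj.ne h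
  have hij' : (Sum.inl i : EdgeDecolored H e c₀ m) ≠ .inl j := fun h => hij (Sum.inl_injective h)
  have hkl' : (Sum.inl k : EdgeDecolored H e c₀ m) ≠ .inl l := fun h => hkl (Sum.inl_injective h)
  have h2 := congrArg (fun x => u (.inl i) (.inl k) * x) h1
  simp only [mul_add, ← mul_assoc, hu.mul_self, hu.row_orthogonal _ hkl',
    hu.col_orthogonal _ hij', zero_mul, add_zero] at h2
  have h3 := congrArg star h2
  simp only [star_mul, hu.star_eq, ← mul_assoc] at h3
  exact h2.symm.trans h3

/-- Insert the row sum of the vertex subdividing {i, j} between the factors. A surviving index is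
adjacent to `k` and `l` and has kind `t`, so it subdivides an edge of color `t` between them. -/
theorem inl_mul_inl_eq_zero {t : T} (ht : t ≠ c₀) {i j k l : W} (hij : (e.labelGraph t).Adj i j)
    (hkl : ¬ (e.labelGraph t).Adj k l) : u (.inl i) (.inl k) * u (.inl j) (.inl l) = 0 := by
  obtain ⟨h, hc⟩ := (SimpleGraph.EdgeLabeling.labelGraph_adj_get e t i j).1 hij
  -- If `k = l`, being adjacent to both no longer determines an edge; column orthogonality settles
  -- this case.
  by_cases hkl' : k = l
  · subst hkl'
    exact hu.col_orthogonal _ fun h' => h.ne (Sum.inl_injective h')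
  let f : {f : H.edgeSet // e f ≠ c₀} := ⟨⟨s(i, j), h⟩, fun h' => ht (hc.symm.trans h')⟩
  have hi : (edgeDecolor H e c₀ m).Adj (.inl i) (EdgeDecolored.mid m f) :=
    ⟨Sym2.mem_mk_left _ _, rfl⟩
  have hj : (edgeDecolor H e c₀ m).Adj (EdgeDecolored.mid m f) (.inl j) :=
    ⟨Sym2.mem_mk_right _ _, rfl⟩
  rw [← mul_one (u (.inl i) (.inl k)), ← hu.row_sum (EdgeDecolored.mid m f), Finset.mul_sum,
    Finset.sum_mul]
  refine Finset.sum_eq_zero fun r _ => ?_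
  by_cases h1 : (edgeDecolor H e c₀ m).Adj (.inl k) r
  swap
  · rw [hu.mul_eq_zero_of_adj hA hi h1, zero_mul]
  by_cases h2 : (edgeDecolor H e c₀ m).Adj r (.inl l)
  swap
  · rw [mul_assoc, hu.mul_eq_zero_of_adj hA hj h2, mul_zero]
  rw [hk _ r, mul_zero, zero_mul]
  rcases r with r | g
  · simp [EdgeDecolored.kind, EdgeDecolored.mid]
  · intro h3
    have h4 : t = e g.1.1 := hc.symm.trans (Option.some_injective _ h3)
    have h5 : (g.1.1 : Sym2 W) = s(k, l) := (Sym2.mem_and_mem_iff hkl').1 ⟨h1.1, h2.1⟩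
    refine hkl ((SimpleGraph.EdgeLabeling.labelGraph_adj k l).2 ⟨(congrArg (· ∈ H.edgeSet) h5).mp g.1.1.2, ?_⟩)
    rw [h4]
    exact congrArg e (Subtype.ext h5.symm)

theorem isQutStarMatrix_submatrix_inl : IsQutStarMatrix H e c₀ (u.submatrix Sum.inl Sum.inl) := by
  have hx := hu.submatrix Sum.inl_injective (preserves_range_inl hk)
  refine { toIsMagicUnitary := hx, edgeColor := fun t => ?_, commute := ?_ }
  · by_cases ht : t = c₀
    -- The edges of color `c₀` are exactly the edges of the decolored graph between original
    -- vertices.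
    · convert hA.submatrix Sum.inl_injective (preserves_range_inl hk) using 1
      ext i j
      rw [SimpleGraph.EdgeLabeling.labelGraph_adj_get, ht]
      rfl
    · refine hx.commutesWithAdj (fun i j a b hij hab => ?_) (fun i j a b hij hab => ?_)
      · exact inl_mul_inl_eq_zero hu hA hk ht hij hab
      · exact inl_mul_inl_eq_zero hu.transpose hA.transpose hk.transpose ht hab hij
  · intro i j k l hij hkl h1 h2
    exact commute_of_edges hu hA hk (f := ⟨⟨s(i, j), hij⟩, h2⟩)
      (g := ⟨⟨s(k, l), hkl⟩, fun h => h2 (h1.trans h)⟩) rfl rfl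

end restrict
end edgeDecolor

/-! ### Extending a Qut* matrix to the subdivided graph -/

section edgeExtend
open scoped Classical
variable {W : Type u} {T : Type w} {H : SimpleGraph W} {e : H.EdgeLabeling T} {c₀ : T} {m : T → ℕ}

/-- The end points of an edge, in an arbitrary order. -/
noncomputable def edgeEnds (f : {f : H.edgeSet // e f ≠ c₀}) : W × W := Quot.out (f.1 : Sym2 W)

theorem mk_edgeEnds (f : {f : H.edgeSet // e f ≠ c₀}) :
    (f.1 : Sym2 W) = s((edgeEnds f).1, (edgeEnds f).2) := (Quot.out_eq _).symm

/-- The matrix indexed by edges that is induced by a matrix `x` indexed by vertices. -/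
noncomputable def edgeMatrix {B : Type*} [NonUnitalNonAssocSemiring B] (x : Matrix W W B) :
    Matrix {f : H.edgeSet // e f ≠ c₀} {f : H.edgeSet // e f ≠ c₀} B := fun f g =>
  x (edgeEnds f).1 (edgeEnds g).1 * x (edgeEnds f).2 (edgeEnds g).2 +
    x (edgeEnds f).1 (edgeEnds g).2 * x (edgeEnds f).2 (edgeEnds g).1

/-- The extension of a matrix indexed by the vertices of `H` to the edge-decolored graph. -/
noncomputable def edgeExtend {B : Type*} [NonUnitalNonAssocSemiring B] (x : Matrix W W B) :
    Matrix (EdgeDecolored H e c₀ m) (EdgeDecolored H e c₀ m) B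
  | .inl i, .inl j => x i j
  | .inr f, .inr g => if f.2.val = g.2.val then edgeMatrix x f.1 g.1 else 0
  | _, _ => 0

theorem SimpleGraph.adj_of_edge_eq {f : {f : H.edgeSet // e f ≠ c₀}} {i j : W}
    (hf : (f.1 : Sym2 W) = s(i, j)) : H.Adj i j :=
  (congrArg (· ∈ H.edgeSet) hf).mp f.1.2

theorem labelGraph_adj_of_edge_eq {f : {f : H.edgeSet // e f ≠ c₀}} {i j : W}
    (hf : (f.1 : Sym2 W) = s(i, j)) : (e.labelGraph (e f.1)).Adj i j :=
  (SimpleGraph.EdgeLabeling.labelGraph_adj i j).2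
    ⟨SimpleGraph.adj_of_edge_eq hf, congrArg e (Subtype.ext hf.symm)⟩

theorem label_eq_of_labelGraph_adj {f : {f : H.edgeSet // e f ≠ c₀}} {i j : W} {t : T}
    (hf : (f.1 : Sym2 W) = s(i, j)) (h : (e.labelGraph t).Adj i j) : e f.1 = t := by
  obtain ⟨h1, h2⟩ := (SimpleGraph.EdgeLabeling.labelGraph_adj i j).1 h
  rw [← h2]
  exact congrArg e (Subtype.ext hf)

variable [Fintype W]

theorem Sym2.sum_sum_ite_eq {B : Type*} [AddCommMonoid B] {k l : W} (h : k ≠ l) (F : W → W → B) :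
    ∑ a, ∑ b, (if s(a, b) = s(k, l) then F a b else 0) = F k l + F l k := by
  have h1 : ∀ a b, (if s(a, b) = s(k, l) then F a b else 0) =
      (if a = k then (if b = l then F k l else 0) else 0) +
        (if a = l then (if b = k then F l k else 0) else 0) := fun a b => by
    simp only [Sym2.eq_iff]
    by_cases hk : a = k
    · subst hk
      by_cases hb : b = l <;> simp [h, hb]
    · by_cases hl : a = l
      · subst hl
        by_cases hb : b = k <;> simp [hk, hb]
      · simp [hk, hl]
  simp only [h1, Finset.sum_add_distrib]
  simp

namespace IsQutStarMatrix
variable {B : Type w'} [CStarAlgebra B] {x : Matrix W W B} (hx : IsQutStarMatrix H e c₀ x)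
include hx

/-- The relations are symmetric in rows and columns, so column statements below reduce to row
statements. -/
theorem transpose : IsQutStarMatrix H e c₀ x.transpose where
  toIsMagicUnitary := hx.toIsMagicUnitary.transpose
  edgeColor t := (hx.edgeColor t).transpose
  commute i j k l hij hkl h1 h2 :=
    hx.commute k l i j hkl hij h1.symm (h1 ▸ h2)

variable {f g : {f : H.edgeSet // e f ≠ c₀}} {i j k l : W}

theorem mul_eq_zero_of_label_ne (hf : (f.1 : Sym2 W) = s(i, j)) (hg : (g.1 : Sym2 W) = s(k, l))
    (h : e f.1 ≠ e g.1) : x i k * x j l = 0 :=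
  hx.mul_eq_zero_of_adj (hx.edgeColor _) (labelGraph_adj_of_edge_eq hf)
    fun h' => h (label_eq_of_labelGraph_adj hg h').symm

/-- For edges of different colors both products vanish, so the commutation relation needs no
equality of colors. -/
theorem mul_comm_of_edges (hf : (f.1 : Sym2 W) = s(i, j)) (hg : (g.1 : Sym2 W) = s(k, l)) :
    x i k * x j l = x j l * x i k := by
  by_cases h : e f.1 = e g.1
  · have h1 : e.get i j (SimpleGraph.adj_of_edge_eq hf) = e f.1 :=
      congrArg e (Subtype.ext hf.symm)
    have h2 : e.get k l (SimpleGraph.adj_of_edge_eq hg) = e g.1 :=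
      congrArg e (Subtype.ext hg.symm)
    exact hx.commute i j k l _ _ (h1.trans (h.trans h2.symm)) (h1 ▸ f.2)
  · rw [hx.mul_eq_zero_of_label_ne hf hg h, hx.mul_eq_zero_of_label_ne (hf.trans Sym2.eq_swap)
      (hg.trans Sym2.eq_swap) h]

/-- The choice of ends in `edgeEnds` does not matter: exchanging the ends of one edge permutes the
two summands, up to the order of factors that commute. -/
theorem edgeMatrix_apply (hf : (f.1 : Sym2 W) = s(i, j)) (hg : (g.1 : Sym2 W) = s(k, l)) :
    edgeMatrix x f g = x i k * x j l + x i l * x j k := by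
  have hg' := hg.trans Sym2.eq_swap
  have h1 := hx.mul_comm_of_edges hf hg
  have h2 := hx.mul_comm_of_edges hf hg'
  unfold edgeMatrix
  rcases Sym2.eq_iff.1 ((mk_edgeEnds f).symm.trans hf) with ⟨a1, a2⟩ | ⟨a1, a2⟩ <;>
  rcases Sym2.eq_iff.1 ((mk_edgeEnds g).symm.trans hg) with ⟨b1, b2⟩ | ⟨b1, b2⟩ <;>
  rw [a1, a2, b1, b2]
  · rw [add_comm]
  · rw [h1, h2, add_comm]
  · rw [h1, h2]

theorem edgeMatrix_transpose : (edgeMatrix x).transpose f g = edgeMatrix x.transpose f g := by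
  rw [Matrix.transpose_apply, hx.edgeMatrix_apply (mk_edgeEnds g) (mk_edgeEnds f),
    hx.transpose.edgeMatrix_apply (mk_edgeEnds f) (mk_edgeEnds g)]
  simp only [Matrix.transpose_apply]
  rw [hx.mul_comm_of_edges (mk_edgeEnds g) ((mk_edgeEnds f).trans Sym2.eq_swap)]

theorem edgeMatrix_eq_zero (h : e f.1 ≠ e g.1) : edgeMatrix x f g = 0 := by
  rw [hx.edgeMatrix_apply (mk_edgeEnds f) (mk_edgeEnds g),
    hx.mul_eq_zero_of_label_ne (mk_edgeEnds f) (mk_edgeEnds g) h,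
    hx.mul_eq_zero_of_label_ne (mk_edgeEnds f) ((mk_edgeEnds g).trans Sym2.eq_swap) h, add_zero]

theorem star_edgeMatrix : star (edgeMatrix x f g) = edgeMatrix x f g := by
  rw [hx.edgeMatrix_apply (mk_edgeEnds f) (mk_edgeEnds g), star_add, star_mul, star_mul]
  simp only [hx.star_eq]
  rw [hx.mul_comm_of_edges (mk_edgeEnds f) (mk_edgeEnds g),
    hx.mul_comm_of_edges (mk_edgeEnds f) ((mk_edgeEnds g).trans Sym2.eq_swap)]

/-- Both summands can be written with an entry of row `i` in front, in a column that is an end of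
`g` and hence different from `a`. This handles the edges between original and subdividing vertices.
-/
theorem mul_edgeMatrix (hf : i ∈ (f.1 : Sym2 W)) {a : W} (ha : a ∉ (g.1 : Sym2 W)) :
    x i a * edgeMatrix x f g = 0 := by
  obtain ⟨j, hj⟩ := hf
  rw [hx.edgeMatrix_apply hj (mk_edgeEnds g), mul_add, ← mul_assoc, ← mul_assoc,
    hx.row_orthogonal i, hx.row_orthogonal i, zero_mul, zero_mul, add_zero]
  · rintro rfl
    exact ha (by rw [mk_edgeEnds g]; exact Sym2.mem_mk_right _ _)
  · rintro rfl
    exact ha (by rw [mk_edgeEnds g]; exact Sym2.mem_mk_left _ _)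

theorem edgeMatrix_mul (hf : i ∈ (f.1 : Sym2 W)) {a : W} (ha : a ∉ (g.1 : Sym2 W)) :
    edgeMatrix x f g * x i a = 0 := by
  have h := congrArg star (hx.mul_edgeMatrix hf ha)
  rwa [star_mul, hx.star_edgeMatrix, hx.star_eq, star_zero] at h

/-- Each summand is a product of commuting projections, and the two summands are orthogonal because
row `j` is. -/
theorem edgeMatrix_mul_self : edgeMatrix x f g * edgeMatrix x f g = edgeMatrix x f g := by
  have hg := mk_edgeEnds g
  have hf := mk_edgeEnds f
  have hkl := (SimpleGraph.adj_of_edge_eq hg).ne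
  have h1 := hx.mul_comm_of_edges hf hg
  have h2 := hx.mul_comm_of_edges hf (hg.trans Sym2.eq_swap)
  rw [hx.edgeMatrix_apply hf hg]
  generalize (edgeEnds f).1 = i at *
  generalize (edgeEnds f).2 = j at *
  generalize (edgeEnds g).1 = k at *
  generalize (edgeEnds g).2 = l at *
  have e1 : x i k * x j l * (x i k * x j l) = x i k * x j l := by
    rw [mul_assoc, ← mul_assoc (x j l), ← h1, mul_assoc (x i k), hx.mul_self, ← mul_assoc,
      hx.mul_self]
  have e2 : x i l * x j k * (x i l * x j k) = x i l * x j k := by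
    rw [mul_assoc, ← mul_assoc (x j k), ← h2, mul_assoc (x i l), hx.mul_self, ← mul_assoc,
      hx.mul_self]
  have e3 : x i k * x j l * (x i l * x j k) = 0 := by
    rw [h2, mul_assoc, ← mul_assoc (x j l), hx.row_orthogonal j hkl.symm, zero_mul, mul_zero]
  have e4 : x i l * x j k * (x i k * x j l) = 0 := by
    rw [h1, mul_assoc, ← mul_assoc (x j k), hx.row_orthogonal j hkl, zero_mul, mul_zero]
  rw [add_mul, mul_add, mul_add, e1, e2, e3, e4, add_zero, zero_add]

/-- With `i` and `j` the ends of `f`, expand 1 as the sum of all `x_ia x_jb`. Pairs not joined by an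
edge of the color of `f` contribute zero, and each other pair belongs to exactly one edge. -/
theorem edgeMatrix_row_sum (f : {f : H.edgeSet // e f ≠ c₀}) : ∑ g, edgeMatrix x f g = 1 := by
  have hf := mk_edgeEnds f
  have h1 (g : {f : H.edgeSet // e f ≠ c₀}) : edgeMatrix x f g = ∑ a, ∑ b,
      if s(a, b) = (g.1 : Sym2 W) then x (edgeEnds f).1 a * x (edgeEnds f).2 b else 0 := by
    have hg := mk_edgeEnds g
    rw [hx.edgeMatrix_apply hf hg, hg, Sym2.sum_sum_ite_eq (SimpleGraph.adj_of_edge_eq hg).ne]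
  simp only [h1]
  rw [Finset.sum_comm, ← hx.row_sum (edgeEnds f).1]
  refine Finset.sum_congr rfl fun a _ => ?_
  rw [Finset.sum_comm]
  conv_rhs => rw [← mul_one (x _ a), ← hx.row_sum (edgeEnds f).2, Finset.mul_sum]
  refine Finset.sum_congr rfl fun b _ => ?_
  by_cases hab : (e.labelGraph (e f.1)).Adj a b
  · obtain ⟨h2, h3⟩ := (SimpleGraph.EdgeLabeling.labelGraph_adj a b).1 hab
    rw [Finset.sum_eq_single ⟨⟨s(a, b), h2⟩, fun h => f.2 (h3.symm.trans h)⟩]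
    · exact if_pos rfl
    · exact fun g _ hg => if_neg fun h => hg (Subtype.ext (Subtype.ext h.symm))
    · simp
  · rw [hx.mul_eq_zero_of_adj (hx.edgeColor _) (labelGraph_adj_of_edge_eq hf) hab]
    exact Finset.sum_eq_zero fun g _ => ite_self _

theorem edgeExtend_transpose :
    (edgeExtend x : Matrix (EdgeDecolored H e c₀ m) _ B).transpose = edgeExtend x.transpose := by
  ext (i | f) (j | g)
  · rfl
  · rfl
  · rfl
  · change (if g.2.val = f.2.val then edgeMatrix x g.1 f.1 else 0) =
      if f.2.val = g.2.val then edgeMatrix x.transpose f.1 g.1 else 0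
    rw [← hx.edgeMatrix_transpose]
    exact if_congr eq_comm rfl rfl

theorem edgeExtend_row_sum (p : EdgeDecolored H e c₀ m) : ∑ q, edgeExtend x p q = 1 := by
  rw [EdgeDecolored.sum_eq]
  rcases p with i | f
  · rw [← hx.row_sum i]
    refine (congrArg _ ?_).trans (add_zero _)
    exact Finset.sum_eq_zero fun g _ => Finset.sum_eq_zero fun a _ => rfl
  · rw [← hx.edgeMatrix_row_sum f.1]
    refine (congrArg₂ _ (Finset.sum_eq_zero fun w _ => rfl) ?_).trans (zero_add _)
    refine Finset.sum_congr rfl fun g _ => ?_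
    change ∑ a : Fin (m (e g.1) + 1), (if f.2.val = a.val then edgeMatrix x f.1 g else 0) = _
    -- Edges of equal color carry paths of equal length, so the position of `f` exists on the path
    -- of `g`.
    by_cases h : e f.1.1 = e g.1
    · rw [Finset.sum_eq_single ⟨f.2.val, by rw [← h]; exact f.2.2⟩]
      · exact if_pos rfl
      · exact fun b _ hb => if_neg fun h' => hb (Fin.ext h'.symm)
      · simp
    · rw [hx.edgeMatrix_eq_zero h]
      simp

theorem isMagicUnitary_edgeExtend :
    IsMagicUnitary (edgeExtend x : Matrix (EdgeDecolored H e c₀ m) _ B) where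
  star_eq := by
    rintro (i | f) (j | g)
    · exact hx.star_eq i j
    · exact star_zero B
    · exact star_zero B
    · change star (if f.2.val = g.2.val then edgeMatrix x f.1 g.1 else 0) =
        if f.2.val = g.2.val then edgeMatrix x f.1 g.1 else 0
      split_ifs
      exacts [hx.star_edgeMatrix, star_zero B]
  mul_self := by
    rintro (i | f) (j | g)
    · exact hx.mul_self i j
    · exact mul_zero (0 : B)
    · exact mul_zero (0 : B)
    · change (if f.2.val = g.2.val then edgeMatrix x f.1 g.1 else 0) *
        (if f.2.val = g.2.val then edgeMatrix x f.1 g.1 else 0) =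
        if f.2.val = g.2.val then edgeMatrix x f.1 g.1 else 0
      split_ifs
      exacts [hx.edgeMatrix_mul_self, mul_zero 0]
  row_sum p := hx.edgeExtend_row_sum p
  col_sum p := by
    have := hx.transpose.edgeExtend_row_sum (m := m) p
    rwa [← hx.edgeExtend_transpose] at this

/-- Entries mixing original and new vertices are zero, so four cases remain: an edge of color `c₀`,
an incidence in either direction, and an edge of an attached path. -/
theorem edgeExtend_mul_edgeExtend {i j a b : EdgeDecolored H e c₀ m}
    (hij : (edgeDecolor H e c₀ m).Adj i j) (hab : ¬ (edgeDecolor H e c₀ m).Adj a b) :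
    edgeExtend x i a * edgeExtend x j b = 0 := by
  have hm := hx.isMagicUnitary_edgeExtend (m := m)
  have hz (f) (w : W) : (edgeExtend x : Matrix (EdgeDecolored H e c₀ m) _ B) (.inr f) (.inl w) =
    0 := rfl
  have hz' (f) (w : W) : (edgeExtend x : Matrix (EdgeDecolored H e c₀ m) _ B) (.inl w) (.inr f) =
    0 := rfl
  have hr (f g) : (edgeExtend x : Matrix (EdgeDecolored H e c₀ m) _ B) (.inr f) (.inr g) =
    if f.2.val = g.2.val then edgeMatrix x f.1 g.1 else 0 := rfl
  rcases i with i | f <;> rcases a with a | f' <;> rcases j with j | g <;> rcases b with b | g' <;>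
    try simp only [hz, hz', zero_mul, mul_zero]
  · refine hx.mul_eq_zero_of_adj (hx.edgeColor c₀) ?_ fun h => hab ?_
    · exact (SimpleGraph.EdgeLabeling.labelGraph_adj _ _).2 hij
    · exact (SimpleGraph.EdgeLabeling.labelGraph_adj _ _).1 h
  · rw [hr]
    split_ifs with h
    · exact hx.mul_edgeMatrix hij.1 fun h' => hab ⟨h', h.symm.trans hij.2⟩
    · exact mul_zero _
  · rw [hr]
    split_ifs with h
    · exact hx.edgeMatrix_mul hij.1 fun h' => hab ⟨h', h.symm.trans hij.2⟩
    · exact zero_mul _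
  · obtain ⟨h1, h2⟩ := hij
    rw [hr, hr]
    by_cases h3 : f.2.val = f'.2.val
    swap
    · rw [if_neg h3, zero_mul]
    by_cases h4 : g.2.val = g'.2.val
    swap
    · rw [if_neg h4, mul_zero]
    have h5 : f'.1 ≠ g'.1 := fun h5 => hab ⟨h5, by omega⟩
    -- Row orthogonality of the edge matrix is read off at height 0, where `edgeExtend` coincides
    -- with it.
    have h6 := hm.row_orthogonal (.inr ⟨f.1, 0⟩) (k := .inr ⟨f'.1, 0⟩) (l := .inr ⟨g'.1, 0⟩)
      fun h => h5 (by
        have h' := Sum.inr.inj h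
        exact (Sigma.mk.inj_iff.1 h').1)
    rw [if_pos h3, if_pos h4, ← h1]
    exact h6

theorem isQutMatrix_edgeExtend :
    IsQutMatrix (edgeDecolor H e c₀ m) (fun _ => ()) (fun _ => ()) (edgeExtend x) where
  toIsMagicUnitary := hx.isMagicUnitary_edgeExtend
  vertexColor _ _ h := absurd rfl h
  edgeColor t := by
    have hlab : SimpleGraph.EdgeLabeling.labelGraph
        (fun _ => () : (edgeDecolor H e c₀ m).EdgeLabeling Unit) t = edgeDecolor H e c₀ m := by
      ext i j
      refine (SimpleGraph.EdgeLabeling.labelGraph_adj (C := (fun _ => () :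
        (edgeDecolor H e c₀ m).EdgeLabeling Unit)) i j).trans ?_
      exact ⟨fun h => h.1, fun h => ⟨h, rfl⟩⟩
    rw [hlab]
    refine hx.isMagicUnitary_edgeExtend.commutesWithAdj (fun i j a b hij hab =>
      hx.edgeExtend_mul_edgeExtend hij hab) fun i j a b hij hab => ?_
    have h := hx.transpose.edgeExtend_mul_edgeExtend (m := m) hab hij
    rwa [← hx.edgeExtend_transpose] at h

end IsQutStarMatrix

omit [Fintype W] in
theorem map_edgeExtend {A B : Type*} [CStarAlgebra A] [CStarAlgebra B] (φ : A →⋆ₐ[ℂ] B)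
    (x : Matrix W W A) (p q : EdgeDecolored H e c₀ m) :
    φ (edgeExtend x p q) = edgeExtend (x.map φ) p q := by
  rcases p with i | f <;> rcases q with j | g
  · rfl
  · exact map_zero φ
  · exact map_zero φ
  · change φ (if f.2.val = g.2.val then edgeMatrix x f.1 g.1 else 0) =
      if f.2.val = g.2.val then edgeMatrix (x.map φ) f.1 g.1 else 0
    split_ifs
    · simp [edgeMatrix]
    · exact map_zero φ

/-- The block on the original vertices determines `u`: mixed entries vanish by kind, `apply_mid_mid`
gives the entries at subdividing vertices, and these are constant along the attached paths. -/
theorem edgeExtend_submatrix {pos len : W → ℕ} (hH : HasPendantPaths H pos len)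
    (hpos : ∀ f : {f : H.edgeSet // e f ≠ c₀}, ∀ x ∈ (f.1 : Sym2 W), pos x = 0)
    {B : Type w'} [CStarAlgebra B] {u : Matrix (EdgeDecolored H e c₀ m) (EdgeDecolored H e c₀ m) B}
    (hu : IsMagicUnitary u) (hA : CommutesWithAdj (edgeDecolor H e c₀ m) u)
    (hk : Preserves u (fun x => (EdgeDecolored.pos pos x, EdgeDecolored.kind x))) :
    edgeExtend (u.submatrix Sum.inl Sum.inl) = u := by
  have hP := hH.edgeDecolor (m := m) hpos
  have hk1 : Preserves u (EdgeDecolored.pos pos) :=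
    hk.of_factor fun i j h => (Prod.ext_iff.1 h).1
  have hk2 : Preserves u EdgeDecolored.kind := hk.of_factor fun i j h => (Prod.ext_iff.1 h).2
  ext (i | f) (j | g)
  · rfl
  · exact (hk2 _ _ (by simp [EdgeDecolored.kind])).symm
  · exact (hk2 _ _ (by simp [EdgeDecolored.kind])).symm
  · change (if f.2.val = g.2.val then edgeMatrix _ f.1 g.1 else 0) = _
    split_ifs with h
    · refine (apply_mid_mid hu hA hk2 (mk_edgeEnds f.1) (mk_edgeEnds g.1)).symm.trans ?_
      obtain ⟨f, a, ha⟩ := f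
      obtain ⟨g, b, hb⟩ := g
      obtain rfl : a = b := h
      induction a with
      | zero => rfl
      | succ a ih =>
        refine (ih (by omega) (by omega)).trans ?_
        have hadj (f : {f : H.edgeSet // e f ≠ c₀}) (h : a + 1 < m (e f.1) + 1) :
            (_root_.edgeDecolor H e c₀ m).Adj (.inr ⟨f, a, by omega⟩) (.inr ⟨f, a + 1, h⟩) :=
          edgeDecolor_adj_inr_inr.2 ⟨rfl, Or.inl rfl⟩
        exact (hP.apply_eq_apply_of_adj hu hA hk1 (hadj f ha) (hadj g hb) rfl rfl rfl).symm
    · exact (hk1 (.inr f) (.inr g) h).symm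

/-- Subdividing the edges of color different from `c₀` and attaching paths to the new vertices
instead of coloring the edges turns `Qut*` into the quantum automorphism group. -/
theorem qutStar_isomorphic_qut_edgeDecolor (H : SimpleGraph W) (e : H.EdgeLabeling T) (c₀ : T)
    (m : T → ℕ) (hm : Set.InjOn m (Set.range e \ {c₀})) {pos len : W → ℕ}
    (hH : HasPendantPaths H pos len)
    (hpos : ∀ f : {f : H.edgeSet // e f ≠ c₀}, ∀ x ∈ (f.1 : Sym2 W), pos x = 0)
    (hdeg : ∀ x, pos x = 0 → 3 ≤ {w | H.Adj x w ∧ pos w = 0}.ncard) :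
    (qutStar H e c₀).Isomorphic (qut (edgeDecolor H e c₀ m) (fun _ => ()) (fun _ => ())) := by
  have hU := isQutMatrix_genMatrix (edgeDecolor H e c₀ m) (fun _ => ())
    (fun _ => () : (edgeDecolor H e c₀ m).EdgeLabeling Unit)
  have hA := commutesWithAdj_of_labelGraph hU.toIsMagicUnitary hU.edgeColor
  have hk := preserves_pos_kind hH hpos hm hdeg hU.toIsMagicUnitary hA
  have hk2 := hk.of_factor (g := EdgeDecolored.kind) fun i j h => (Prod.ext_iff.1 h).2
  have hX := isQutStarMatrix_genMatrix H e c₀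
  let Φ := (qutStarRelations H e c₀).lift (v := fun p => (qutRelations _ _ _).genMatrix
    (Sum.inl p.1) (Sum.inl p.2)) (isQutStarMatrix_submatrix_inl hU.toIsMagicUnitary hA hk2)
  let Ψ := (qutRelations (edgeDecolor H e c₀ m) (fun _ => ())
    (fun _ => () : (edgeDecolor H e c₀ m).EdgeLabeling Unit)).lift
    (v := fun p => edgeExtend (qutStarRelations H e c₀).genMatrix p.1 p.2)
    hX.isQutMatrix_edgeExtend
  have hΦ : ∀ i j, Φ ((qutStarRelations H e c₀).genMatrix i j) = (qutRelations _ _ _).genMatrix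
      (Sum.inl i) (Sum.inl j) :=
    fun i j => CStarRelations.lift_gen _ _ (i, j)
  have hΨ : ∀ i j, Ψ ((qutRelations _ _ _).genMatrix i j) =
      edgeExtend (qutStarRelations H e c₀).genMatrix i j :=
    fun i j => CStarRelations.lift_gen _ _ (i, j)
  refine CompactMatrixQuantumGroup.isomorphic_of_block (𝔾 := qutStar H e c₀) Φ Ψ
    Sum.inl Sum.inl_injective hΦ ?_ ?_ ?_
  · intro i j
    exact hΨ _ _
  · intro a b
    -- The entries of `edgeExtend` are polynomials in those of the matrix, so `Φ` may be applied to
    -- the matrix first, which produces the block of original vertices.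
    refine (congrArg Φ (hΨ a b)).trans ((map_edgeExtend Φ _ a b).trans ?_)
    have h1 : (qutStarRelations H e c₀).genMatrix.map Φ =
        (qutRelations (edgeDecolor H e c₀ m) (fun _ => ()) (fun _ => ())).genMatrix.submatrix
          Sum.inl Sum.inl := by
      ext i j
      exact hΦ i j
    rw [h1]
    exact congrFun (congrFun (edgeExtend_submatrix hH hpos hU.toIsMagicUnitary hA hk) a) b
  · intro i z hz
    exact preserves_range_inl hk2 _ _ (by simpa using hz)

end edgeExtend

/-! ### The chain of isomorphisms -/

/-- Path edges have color `c₀`, so any edge of another color comes from `G`. Hence no new colors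
arise, and only edges between base vertices are subdivided. -/
theorem vertexDecolorLabel_mem_range {V : Type u} {S : Type v} {T : Type w} (G : SimpleGraph V)
    (c : V → S) (n : S → ℕ) (e : G.EdgeLabeling T) (c₀ : T)
    (f : {f : (vertexDecolor G c n).edgeSet // vertexDecolorLabel G c n e c₀ f ≠ c₀}) :
    vertexDecolorLabel G c n e c₀ f.1 ∈ Set.range e ∧
      ∀ x ∈ (f.1 : Sym2 (VertexDecolored c n)), x.2.val = 0 := by
  have hx := labelGraph_adj_of_edge_eq (mk_edgeEnds f)
  have hf := mk_edgeEnds f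
  rw [labelGraph_vertexDecolorLabel_adj] at hx
  rcases hx with ⟨h1, h2, h3⟩ | ⟨_, _, h3⟩
  · obtain ⟨h4, h5⟩ := (SimpleGraph.EdgeLabeling.labelGraph_adj _ _).1 h3
    refine ⟨⟨_, h5⟩, fun x hx => ?_⟩
    rw [hf] at hx
    rcases Sym2.mem_iff.1 hx with rfl | rfl
    exacts [h1, h2]
  · exact absurd h3 f.2

theorem corollary4p10 {V : Type u} [Fintype V] {S : Type v} {T : Type w}
    (G : SimpleGraph V) [DecidableRel G.Adj] (c : V → S) (e : G.EdgeLabeling T)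
    (n : S → ℕ) (hn : Set.InjOn n (Set.range c))
    (c₀ : T) (m : T → ℕ) (hm : Set.InjOn m (Set.range e \ {c₀}))
    (hdeg : ∀ v, 3 ≤ G.degree v)
    (h : (qutStar (vertexDecolor G c n) (vertexDecolorLabel G c n e c₀) c₀).Isomorphic
      (qut (vertexDecolor G c n) (fun _ => ()) (vertexDecolorLabel G c n e c₀))) :
    (qut (edgeDecolor (vertexDecolor G c n) (vertexDecolorLabel G c n e c₀) c₀ m)
      (fun _ => ()) (fun _ => ())).Isomorphic (qut G c e) := by
  have hd : ∀ v, 3 ≤ {w | G.Adj v w}.ncard := fun v => by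
    refine (hdeg v).trans (le_of_eq ?_)
    rw [← SimpleGraph.card_neighborSet_eq_degree, ← Nat.card_eq_fintype_card]
    rfl
  have hd2 : ∀ v, 2 ≤ {w | G.Adj v w}.ncard := fun v => le_trans (by norm_num) (hd v)
  refine ((qutStar_isomorphic_qut_edgeDecolor _ _ c₀ m (hm.mono ?_)
    (hasPendantPaths_vertexDecolor G c n hd2) (fun f =>
      (vertexDecolorLabel_mem_range G c n e c₀ f).2) ?_).symm.trans h).trans
    (qut_isomorphic_qut_vertexDecolor G c e n hn c₀ hd2).symm
  · rintro _ ⟨⟨f, rfl⟩, hf⟩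
    exact ⟨(vertexDecolorLabel_mem_range G c n e c₀ ⟨f, hf⟩).1, hf⟩
  -- The neighbors of `x.1` in `G` reappear as base neighbors of `x`, so the degree bound carries
  -- over to G'.
  · intro x hx
    refine (hd x.1).trans ?_
    rw [← Set.ncard_image_of_injective _ (VertexDecolored.base_injective c n)]
    refine Set.ncard_le_ncard ?_
    rintro _ ⟨w, hw, rfl⟩
    exact ⟨Or.inl ⟨hx, rfl, hw⟩, rfl⟩
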